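/- Let $(A,\mathfrak m)$ be a complete Noetherian local ring of dimension $d$ which is equicharacteristic (that is, $\operatorname{char} A=\operatorname{char} A/\mathfrak m$), and let $\mathfrak a$ be an $\mathfrak m$-primary ideal of $A$. Write $\mu(-)$ for the minimal number of generators of an ideal. A Noetherian local ring is called a complete intersection (CI) if its completion is the quotient of a regular local ring by an ideal generated by a regular sequence, and a Noetherian ring is CI if all its localizations at prime ideals are CI. For a Noetherian local ring $(B,\mathfrak n)$, an ideal $\mathfrak b$ of $B$ and a local ring homomorphism $\varphi\colon B\to A$, we say that $[B,\mathfrak n,\mathfrak b,\varphi]$ is a CI-approximation of $[A,\mathfrak m,\mathfrak a]$ if $\varphi(\mathfrak b)A=\mathfrak a$, $A$ is a finitely generated $B$-module via $\varphi$, $\dim A=\dim B$, and both $B$ and the associated graded ring $G_{\mathfrak b}(B)=\bigoplus_{n\ge 0}\mathfrak b^n/\mathfrak b^{n+1}$ are CI. (1) There is a CI-approximation $[B,\mathfrak n,\mathfrak n,\varphi]$ of $[A,\mathfrak m,\mathfrak a]$ such that $\varphi$ induces an isomorphism $B/\mathfrak n\cong A/\mathfrak m$ and $\mu(\mathfrak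 n)=\mu(\mathfrak a)$. (2) Suppose that $\mu(\mathfrak a)>d$ and that the residue field $A/\mathfrak m$ is infinite. Then for every integer $r\ge 0$ there is a CI-approximation $[B',\mathfrak n',\mathfrak n',\varphi']$ of $[A,\mathfrak m,\mathfrak a]$ such that $\varphi'$ induces an isomorphism $B'/\mathfrak n'\cong A/\mathfrak m$, $\mu(\mathfrak n')=\mu(\mathfrak a)$ and $\operatorname{red}(\mathfrak n',B')>r$. Here a reduction of an ideal $I$ is an ideal $\mathfrak c\subseteq I$ with $\mathfrak c I^n=I^{n+1}$ for some $n\ge 0$, a minimal reduction is a reduction that is minimal under inclusion, and $\operatorname{red}(I,B')$ is the minimum, over all minimal reductions $\mathfrak c$ of $I$, of the least $n\ge 0$ with $\mathfrak c I^n=I^{n+1}$. -/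

import Mathlib

open IsLocalRing

universe u

/-- The ideal `⨁ₙ Iⁿ⁺¹ tⁿ` of the Rees algebra `⨁ₙ Iⁿ tⁿ ⊆ R[t]`. -/
def associatedGradedIdeal {R : Type u} [CommRing R] (I : Ideal R) : Ideal (reesAlgebra I) where
  carrier := {f | ∀ n : ℕ, (f : Polynomial R).coeff n ∈ I ^ (n + 1)}
  zero_mem' := fun n => by simp
  add_mem' := fun {f g} hf hg n => by
    simpa using Ideal.add_mem _ (hf n) (hg n)
  smul_mem' := fun g f hf n => by
    rw [smul_eq_mul, MulMemClass.coe_mul, Polynomial.coeff_mul]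
    refine Ideal.sum_mem _ fun ij hij => ?_
    have h : ij.1 + (ij.2 + 1) = n + 1 := by
      rw [← Finset.HasAntidiagonal.mem_antidiagonal.mp hij, add_assoc]
    rw [← h, pow_add]
    exact Ideal.mul_mem_mul (g.2 ij.1) (hf ij.2)

/-- The associated graded ring `G_I(R) = ⨁ₙ Iⁿ / Iⁿ⁺¹`, as the quotient of the Rees algebra
`⨁ₙ Iⁿ tⁿ` by its ideal `⨁ₙ Iⁿ⁺¹ tⁿ`. -/
abbrev AssociatedGradedRing {R : Type u} [CommRing R] (I : Ideal R) : Type u :=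
  reesAlgebra I ⧸ associatedGradedIdeal I

/-- A Noetherian local ring is a complete intersection if its completion is the quotient of a
regular local ring by an ideal generated by a regular sequence. -/
def IsCompleteIntersectionLocalRing (R : Type u) [CommRing R] [IsLocalRing R] : Prop :=
  IsNoetherianRing R ∧
    ∃ (S : Type u) (_ : CommRing S) (_ : IsRegularLocalRing S) (rs : List S),
      RingTheory.Sequence.IsRegular S rs ∧
        Nonempty (AdicCompletion (maximalIdeal R) R ≃+* S ⧸ Ideal.ofList rs)

/-- A Noetherian ring is a complete intersection if all its localizations at prime ideals are
complete intersection local rings. -/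
def IsCompleteIntersectionRing (R : Type u) [CommRing R] : Prop :=
  IsNoetherianRing R ∧
    ∀ (p : Ideal R) [p.IsPrime], IsCompleteIntersectionLocalRing (Localization.AtPrime p)

/-- `[B, 𝔫, 𝔟, φ]` is a complete intersection approximation of `[A, 𝔪, 𝔞]`, where
`φ : (B, 𝔫) → (A, 𝔪)` is a local homomorphism of local rings. -/
structure IsCIApproximation {A B : Type u} [CommRing A] [IsLocalRing A]
    [CommRing B] [IsLocalRing B] (φ : B →+* A) [IsLocalHom φ]
    (𝔟 : Ideal B) (𝔞 : Ideal A) : Prop where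
  map_eq : 𝔟.map φ = 𝔞
  finite : φ.Finite
  dim_eq : ringKrullDim A = ringKrullDim B
  isCI : IsCompleteIntersectionLocalRing B
  isCI_graded : IsCompleteIntersectionRing (AssociatedGradedRing 𝔟)

/-- `𝔠` is a reduction of `I`: `𝔠 ⊆ I` and `𝔠 Iⁿ = Iⁿ⁺¹` for some `n`. -/
def IsReduction {R : Type u} [CommRing R] (𝔠 I : Ideal R) : Prop :=
  𝔠 ≤ I ∧ ∃ n : ℕ, 𝔠 * I ^ n = I ^ (n + 1)

/-- `𝔠` is a minimal reduction of `I`, i.e. a reduction minimal under inclusion. -/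
def IsMinimalReduction {R : Type u} [CommRing R] (𝔠 I : Ideal R) : Prop :=
  Minimal (fun J : Ideal R => IsReduction J I) 𝔠

/-- The reduction number of `I` with respect to a reduction `𝔠`: the least `n` with
`𝔠 Iⁿ = Iⁿ⁺¹`. -/
noncomputable def reductionNumberWrt {R : Type u} [CommRing R] (𝔠 I : Ideal R) : ℕ :=
  sInf {n : ℕ | 𝔠 * I ^ n = I ^ (n + 1)}

/-- The reduction number of `I`: the minimum of the reduction numbers of `I` with respect to its
minimal reductions. -/
noncomputable def reductionNumber {R : Type u} [CommRing R] (I : Ideal R) : ℕ :=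
  sInf {m : ℕ | ∃ 𝔠 : Ideal R, IsMinimalReduction 𝔠 I ∧ reductionNumberWrt 𝔠 I = m}

/-!
The ring `A` has a coefficient field `k` (`exists_coefficientField`). Let `P = k[x₁, …, xₙ]` with
`n = μ(𝔞)`, and let `S` be the ring of power series in the same variables, realized as the
completion of `P` at the ideal generated by the variables. Sending the variables to generators of
`𝔞` defines a finite homomorphism `S → A` (`exists_finite_ringHom_adicCompletion`). Let `K` be its
kernel and `K* ⊆ P` the ideal of initial forms of `K`. The approximation is `B = S/(f₁, …, fⱼ)`,
where `j = n - dim A` and the `fᵢ ∈ K` are chosen so that their initial forms `Fᵢ` are a regular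
sequence in `P`.

Such `fᵢ` exist because `P/K*` has dimension at most `dim A`. Indeed, if more than `dim A` of the
variables were algebraically independent modulo `K*`, then, by the Artin–Rees lemma, the monomials
in them would give too many linearly independent elements of `A/𝔞ᵐ`
(`ringKrullDim_quotient_le_of_initialIdeal_le`). A homogeneous ideal of codimension at least `j`
contains a regular sequence of `j` forms, by homogeneous prime avoidance and unmixedness at the
origin, and their degrees can be made arbitrarily large by passing to powers
(`exists_isWeaklyRegular_isHomogeneous`). If the `Fᵢ` are a regular sequence, then so are the `fᵢ`,
and the `Fᵢ` generate the initial ideal of `(f₁, …, fⱼ)`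
(`isWeaklyRegular_and_initialIdeal_ofList`). So the associated graded ring of the maximal ideal of
`B` is `P/(F₁, …, Fⱼ)`, and both it and `B` are complete intersections, as quotients of regular
rings by regular sequences (`isCompleteIntersectionRing_associatedGradedRing`,
`isCompleteIntersectionLocalRing_of_surjective`). This is `exists_isCIApproximation`.

For the reduction number, choose all `fᵢ` of order at least `r + 2`. Since `n > dim A`, there is at
least one equation, and since `k` is infinite, some line through the origin is not contained in the
tangent cone of `B`; its ideal induces a proper reduction of the maximal ideal `𝔫` of `B`
(`exists_isReduction_ne_maximalIdeal`), so that every minimal reduction `𝔠` is proper. Modulo `𝔫²`,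
such a `𝔠` is generated by fewer than `n` elements. An equality `𝔠𝔫ⁱ = 𝔫ⁱ⁺¹` with `i ≤ r` would lift
to `S`, since `B` and `S` agree up to order `r + 2`, and a power of the maximal ideal of `S` would
lie in an ideal with fewer than `n = dim S` generators, contrary to Krull's height theorem
(`lt_of_mul_pow_eq_pow_succ`).
-/

/-! ### Coefficient fields -/

/-- Square-zero lifting for fields of characteristic `p`. Partial lifts are encoded by their graphs,
subrings of `k × B`; any lift is forced to send `x ^ p` to `y ^ p`, where `y` is an arbitrary lift
of `f x`, and a maximal graph containing these pairs projects onto `k` because adjoining an element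
`b` to a subfield containing `k ^ p` amounts to adjoining a root of `X ^ p - b ^ p`. -/
theorem exists_ringHom_lift_of_sq_eq_bot {k B : Type*} [Field k] [CommRing B] (p : ℕ)
    [hp : Fact p.Prime] [CharP k p] [CharP B p] (I : Ideal B) (hI : I ^ 2 = ⊥)
    (f : k →+* B ⧸ I) : ∃ g : k →+* B, (Ideal.Quotient.mk I).comp g = f := by
  classical
  -- A good subring is the graph of a partial lift defined at least on the `p`-th powers.
  let good : Set (Subring (k × B)) := {G | (∀ z ∈ G, f z.1 = Ideal.Quotient.mk I z.2) ∧
    (∀ z ∈ G, z.1 = 0 → z.2 = 0) ∧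
    ∀ (x : k) (y : B), f x = Ideal.Quotient.mk I y → (x ^ p, y ^ p) ∈ G}
  let E₀ : Subring (k × B) := RingHom.eqLocus (f.comp (RingHom.fst k B))
    ((Ideal.Quotient.mk I).comp (RingHom.snd k B))
  have hE₀ : ∀ z : k × B, z ∈ E₀ ↔ f z.1 = Ideal.Quotient.mk I z.2 := fun z => Iff.rfl
  let Fr : k × B →+* k × B := RingHom.prodMap (frobenius k p) (frobenius B p)
  have h₀ : E₀.map Fr ∈ good := by
    refine ⟨?_, ?_, ?_⟩
    · rintro _ ⟨z, hz, rfl⟩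
      have hz' := (hE₀ z).1 hz
      simp [Fr, frobenius_def, hz', map_pow]
    · rintro _ ⟨z, hz, rfl⟩ h
      have hz' := (hE₀ z).1 hz
      have h1 : z.1 = 0 := by simpa [Fr, frobenius_def, hp.1.ne_zero] using h
      rw [h1, map_zero, eq_comm, Ideal.Quotient.eq_zero_iff_mem] at hz'
      have h2 : z.2 ^ 2 = 0 := by
        have : z.2 ^ 2 ∈ I ^ 2 := Ideal.pow_mem_pow hz' 2
        simpa [hI] using this
      obtain ⟨m, hm⟩ := Nat.exists_eq_add_of_le hp.1.two_le
      simp [Fr, frobenius_def, hm, pow_add, h2]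
    · intro x y hxy
      exact ⟨(x, y), (hE₀ _).2 hxy, by simp [Fr, frobenius_def]⟩
  -- The `p`-th powers of all compatible pairs form a good subring: `y ^ p` depends only on `y`
  -- modulo `I`, as `I ^ p = 0`. A maximal good subring is the graph of a lift `φ` on a subfield
  -- `L`.
  obtain ⟨G, -, hG⟩ := zorn_le_nonempty₀ good (fun c hc hchain y hy => by
    have hdir : DirectedOn (· ≤ ·) c := hchain.directedOn
    have hmem : ∀ z, z ∈ sSup c ↔ ∃ s ∈ c, z ∈ s :=
      fun z => Subring.mem_sSup_of_directedOn ⟨y, hy⟩ hdir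
    refine ⟨sSup c, ⟨?_, ?_, ?_⟩, fun z hz => le_sSup hz⟩
    · intro z hz
      obtain ⟨s, hs, hz⟩ := (hmem z).1 hz
      exact (hc hs).1 z hz
    · intro z hz
      obtain ⟨s, hs, hz⟩ := (hmem z).1 hz
      exact (hc hs).2.1 z hz
    · intro a b hab
      exact (hmem _).2 ⟨y, hy, (hc hy).2.2 a b hab⟩) _ h₀
  obtain ⟨⟨hG1, hG2, hG3⟩, hGmax⟩ := hG
  let L : Subfield k :=
    { G.map (RingHom.fst k B) with
      inv_mem' := by
        rintro x ⟨z, hz, rfl⟩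
        change (z.1)⁻¹ ∈ G.map (RingHom.fst k B)
        obtain ⟨y, hy⟩ := Ideal.Quotient.mk_surjective (f (z.1)⁻¹)
        have h1 := hG3 _ _ hy.symm
        by_cases h0 : z.1 = 0
        · rw [h0, inv_zero]; exact Subring.zero_mem _
        · refine ⟨z ^ (p - 1) * (z.1⁻¹ ^ p, y ^ p), G.mul_mem (G.pow_mem hz _) h1, ?_⟩
          change z.1 ^ (p - 1) * z.1⁻¹ ^ p = z.1⁻¹
          obtain ⟨m, hm⟩ := Nat.exists_eq_succ_of_ne_zero hp.1.ne_zero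
          rw [hm, Nat.succ_sub_one, pow_succ, ← mul_assoc, ← mul_pow, mul_inv_cancel₀ h0, one_pow,
            one_mul] }
  have hL : ∀ x, x ∈ L ↔ ∃ y, (x, y) ∈ G := fun x =>
    ⟨fun ⟨z, hz, h⟩ => ⟨z.2, by rw [← h]; exact hz⟩, fun ⟨y, hy⟩ => ⟨(x, y), hy, rfl⟩⟩
  let pr : G →+* L := ((RingHom.fst k B).comp G.subtype).codRestrict L
    fun z => (hL _).2 ⟨z.1.2, z.2⟩
  have hpr : Function.Bijective pr := by
    refine ⟨(injective_iff_map_eq_zero pr).2 fun z hz => ?_, fun x => ?_⟩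
    · have h1 : z.1.1 = 0 := congrArg Subtype.val hz
      exact Subtype.ext (Prod.ext h1 (hG2 _ z.2 h1))
    · obtain ⟨y, hy⟩ := (hL _).1 x.2
      exact ⟨⟨(x, y), hy⟩, rfl⟩
  let e : G ≃+* L := RingEquiv.ofBijective pr hpr
  let φ : L →+* B := ((RingHom.snd k B).comp G.subtype).comp e.symm.toRingHom
  have hφG : ∀ x : L, ((x : k), φ x) ∈ G := fun x => by
    have h1 : e (e.symm x) = x := e.apply_symm_apply x
    have h2 : ((e.symm x : G) : k × B).1 = x := congrArg Subtype.val h1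
    have h3 : ((x : k), φ x) = ((e.symm x : G) : k × B) := Prod.ext h2.symm rfl
    rw [h3]; exact (e.symm x).2
  have hφ : ∀ x : L, ∀ y, ((x : k), y) ∈ G → φ x = y := fun x y hy => by
    have := hG2 _ (G.sub_mem (hφG x) hy) (by simp)
    simpa [sub_eq_zero] using this
  have htop : ∀ b, b ∈ L := by
    intro b
    by_contra hb
    obtain ⟨c, hc⟩ := Ideal.Quotient.mk_surjective (f b)
    have hbp : b ^ p ∈ L := (hL _).2 ⟨_, hG3 _ _ hc.symm⟩
    have hφb : φ ⟨b ^ p, hbp⟩ = c ^ p := hφ _ _ (hG3 _ _ hc.symm)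
    -- If `b ∉ L`, then `X ^ p - b ^ p` is the minimal polynomial of `b` over `L`, and `φ` extends
    -- to `L(b)` by sending `b` to an arbitrary lift `c` of its image.
    let Q : Polynomial L := Polynomial.X ^ p - Polynomial.C ⟨b ^ p, hbp⟩
    have hQirr : Irreducible Q := X_pow_sub_C_irreducible_of_prime hp.1 fun b' hb' => by
      have h1 : (b' : k) ^ p = b ^ p := congrArg Subtype.val hb'
      have h2 : (b' : k) = b := frobenius_inj k p h1
      exact hb (h2 ▸ b'.2)
    have hQmin : minpoly L b = Q :=
      (minpoly.eq_of_irreducible_of_monic hQirr (by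
        simp only [Q, map_sub, map_pow, Polynomial.aeval_X, Polynomial.aeval_C]
        exact sub_self _) (Polynomial.monic_X_pow_sub_C _ hp.1.ne_zero)).symm
    let ev₁ : Polynomial L →+* k := Polynomial.eval₂RingHom L.subtype b
    let ev₂ : Polynomial L →+* B := Polynomial.eval₂RingHom φ c
    have hcomp : f.comp ev₁ = (Ideal.Quotient.mk I).comp ev₂ := by
      refine Polynomial.ringHom_ext' (RingHom.ext fun x => ?_) ?_
      · simpa [ev₁, ev₂] using hG1 _ (hφG x)
      · simp [ev₁, ev₂, hc]
    have hle : G ≤ (ev₁.prod ev₂).range := by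
      rintro ⟨x, y⟩ hz
      have hx : x ∈ L := (hL _).2 ⟨y, hz⟩
      refine ⟨Polynomial.C ⟨x, hx⟩, ?_⟩
      refine Prod.ext ?_ ?_
      · simp [ev₁]
      · simpa [ev₂] using hφ ⟨x, hx⟩ y hz
    have hbig : (ev₁.prod ev₂).range ∈ good := by
      refine ⟨?_, ?_, fun x y hxy => hle (hG3 x y hxy)⟩
      · rintro _ ⟨q, rfl⟩
        exact congrArg (fun h : Polynomial L →+* B ⧸ I => h q) hcomp
      · rintro _ ⟨q, rfl⟩ h0
        have h0' : Polynomial.aeval b q = 0 := h0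
        obtain ⟨q', rfl⟩ : Q ∣ q := hQmin ▸ minpoly.dvd L b h0'
        change ev₂ (Q * q') = 0
        rw [map_mul]
        have : ev₂ Q = 0 := by simp [ev₂, Q, hφb]
        rw [this, zero_mul]
    have hmem : ((b, c) : k × B) ∈ G := hGmax hbig hle ⟨Polynomial.X, by simp [ev₁, ev₂]⟩
    exact hb ((hL _).2 ⟨c, hmem⟩)
  refine ⟨φ.comp (RingHom.codRestrict (RingHom.id k) L htop), RingHom.ext fun x => ?_⟩
  exact (hG1 _ (hφG ⟨x, htop x⟩)).symm

/-- Every field is formally smooth over its prime field, in positive characteristic. -/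
theorem formallySmooth_zmod (k : Type*) [Field k] (p : ℕ) [Fact p.Prime] [CharP k p]
    [Algebra (ZMod p) k] : Algebra.FormallySmooth (ZMod p) k := by
  refine Algebra.FormallySmooth.of_comp_surjective fun B _ _ I hI f => ?_
  rcases subsingleton_or_nontrivial B with hB | hB
  · refine ⟨⟨⟨⟨⟨fun _ => 0, Subsingleton.elim _ _⟩, fun _ _ => Subsingleton.elim _ _⟩,
      Subsingleton.elim _ _, fun _ _ => Subsingleton.elim _ _⟩, fun _ => Subsingleton.elim _ _⟩, ?_⟩
    have : Subsingleton (B ⧸ I) := Ideal.Quotient.mk_surjective.subsingleton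
    exact AlgHom.ext fun _ => Subsingleton.elim _ _
  · have : CharP B p := charP_of_injective_algebraMap (algebraMap (ZMod p) B).injective p
    obtain ⟨g, hg⟩ := exists_ringHom_lift_of_sq_eq_bot p I hI f.toRingHom
    refine ⟨{ g with commutes' := fun r => ?_ }, AlgHom.ext fun x => congrArg (fun h => h x) hg⟩
    exact congrArg (fun h : ZMod p →+* B => h r) (Subsingleton.elim (g.comp (algebraMap _ k)) _)

/-- Every field of characteristic zero is formally smooth over `ℚ`: it is algebraic, hence
separable, over a purely transcendental extension. -/
theorem formallySmooth_rat (k : Type*) [Field k] [Algebra ℚ k] : Algebra.FormallySmooth ℚ k := by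
  obtain ⟨s, hs⟩ := exists_isTranscendenceBasis ℚ k
  have : CharZero k := algebraRat.charZero k
  have : Algebra.IsAlgebraic (IntermediateField.adjoin ℚ (Set.range ((↑) : s → k))) k :=
    hs.isAlgebraic_field
  exact Algebra.FormallySmooth.of_algebraicIndependent_of_isSeparable hs.1

/-- Formal smoothness lifts the identity of the residue field through the successive square-zero
extensions `A / 𝔪ⁱ⁺¹ → A / 𝔪ⁱ`. -/
theorem exists_coefficientField_of_formallySmooth (F : Type*) {A : Type*} [Field F] [CommRing A]
    [IsLocalRing A] [IsAdicComplete (maximalIdeal A) A] [Algebra F A]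
    (_ : Algebra.FormallySmooth F (ResidueField A)) :
    ∃ σ : ResidueField A →+* A, (residue A).comp σ = RingHom.id _ := by
  obtain ⟨g, hg⟩ := Algebra.FormallySmooth.exists_mkₐ_comp_eq_of_isAdicComplete
    (I := maximalIdeal A) (AlgHom.id F (ResidueField A))
  exact ⟨g.toRingHom, RingHom.ext fun x => congrArg (fun h => h x) hg⟩

/-- **Cohen**: an equicharacteristic complete local ring has a coefficient field. -/
theorem exists_coefficientField {A : Type*} [CommRing A] [IsLocalRing A]
    [IsAdicComplete (maximalIdeal A) A] (h : ringChar A = ringChar (ResidueField A)) :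
    ∃ σ : ResidueField A →+* A, (residue A).comp σ = RingHom.id _ := by
  rcases CharP.exists' (ResidueField A) with h0 | ⟨p, hp, hpk⟩
  · have hu : ∀ y : nonZeroDivisors ℤ, IsUnit (Int.castRingHom A y) := fun y => by
      rw [← residue_ne_zero_iff_isUnit, eq_intCast, map_intCast]
      exact Int.cast_ne_zero.2 (nonZeroDivisors.ne_zero y.2)
    let alg : Algebra ℚ A := (IsLocalization.lift hu : ℚ →+* A).toAlgebra
    exact exists_coefficientField_of_formallySmooth ℚ
      (@formallySmooth_rat (ResidueField A) _ (ResidueField.algebra A))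
  · have : CharP A p := ringChar.of_eq (h.trans (ringChar.eq (ResidueField A) p))
    let _ : Algebra (ZMod p) A := ZMod.algebra A p
    exact exists_coefficientField_of_formallySmooth (ZMod p) (formallySmooth_zmod _ p)

/-! ### Maps between adic completions -/

theorem AdicCompletion.factorPow_evalₐ {R : Type*} [CommRing R] (I : Ideal R) {m n : ℕ}
    (h : m ≤ n) (x : AdicCompletion I R) :
    Ideal.Quotient.factorPow I h (AdicCompletion.evalₐ I n x) = AdicCompletion.evalₐ I m x := by
  apply AdicCompletion.induction_on I R x
  intro a
  rw [AdicCompletion.evalₐ_mk, AdicCompletion.evalₐ_mk]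
  exact AdicCompletion.Ideal.mk_eq_mk I h a

theorem Ideal.pow_le_comap_pow_of_le_comap {R S : Type*} [CommRing R] [CommRing S] {I : Ideal R}
    {J : Ideal S} {g : R →+* S} (h : I ≤ J.comap g) (n : ℕ) : I ^ n ≤ (J ^ n).comap g :=
  (Ideal.pow_right_mono h n).trans (Ideal.le_comap_pow g n)

theorem AdicCompletion.factorPow_comp_quotientMap_evalₐ {R S : Type*} [CommRing R] [CommRing S]
    (I : Ideal R) (J : Ideal S) (g : R →+* S) (h : I ≤ J.comap g) {m n : ℕ} (hmn : m ≤ n) :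
    (Ideal.Quotient.factorPow J hmn).comp
      ((Ideal.quotientMap (J ^ n) g (Ideal.pow_le_comap_pow_of_le_comap h n)).comp
        (AdicCompletion.evalₐ I n : AdicCompletion I R →+* R ⧸ I ^ n)) =
      (Ideal.quotientMap (J ^ m) g (Ideal.pow_le_comap_pow_of_le_comap h m)).comp
        (AdicCompletion.evalₐ I m : AdicCompletion I R →+* R ⧸ I ^ m) := by
  ext x
  simp only [RingHom.comp_apply, RingHom.coe_coe]
  rw [← AdicCompletion.factorPow_evalₐ I hmn x]
  obtain ⟨y, hy⟩ := Ideal.Quotient.mk_surjective (AdicCompletion.evalₐ I n x)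
  rw [← hy]
  simp [Ideal.Quotient.factorPow]

/-- The ring homomorphism between adic completions induced by a ring homomorphism which maps the
first ideal into the second one. -/
noncomputable def AdicCompletion.mapRingHom {R S : Type*} [CommRing R] [CommRing S] (I : Ideal R)
    (J : Ideal S) (g : R →+* S) (h : I ≤ J.comap g) : AdicCompletion I R →+* AdicCompletion J S :=
  AdicCompletion.liftRingHom J
    (fun n => (Ideal.quotientMap (J ^ n) g (Ideal.pow_le_comap_pow_of_le_comap h n)).comp
      (AdicCompletion.evalₐ I n : AdicCompletion I R →+* R ⧸ I ^ n))
    (AdicCompletion.factorPow_comp_quotientMap_evalₐ I J g h)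

theorem AdicCompletion.evalₐ_mapRingHom {R S : Type*} [CommRing R] [CommRing S] (I : Ideal R)
    (J : Ideal S) (g : R →+* S) (h : I ≤ J.comap g) (n : ℕ) (x : AdicCompletion I R) :
    AdicCompletion.evalₐ J n (AdicCompletion.mapRingHom I J g h x) =
      Ideal.quotientMap (J ^ n) g (Ideal.pow_le_comap_pow_of_le_comap h n)
        (AdicCompletion.evalₐ I n x) := by
  exact AdicCompletion.evalₐ_liftRingHom J _
    (AdicCompletion.factorPow_comp_quotientMap_evalₐ I J g h) n x

theorem AdicCompletion.evalₐ_algebraMap {R : Type*} [CommRing R] (I : Ideal R) (n : ℕ) (x : R) :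
    AdicCompletion.evalₐ I n (algebraMap R (AdicCompletion I R) x) = Ideal.Quotient.mk (I ^ n) x :=
  AdicCompletion.evalₐ_of I n x

theorem AdicCompletion.mapRingHom_algebraMap {R S : Type*} [CommRing R] [CommRing S] (I : Ideal R)
    (J : Ideal S) (g : R →+* S) (h : I ≤ J.comap g) (x : R) :
    AdicCompletion.mapRingHom I J g h (algebraMap R _ x) = algebraMap S _ (g x) := by
  refine AdicCompletion.ext_evalₐ fun n => ?_
  rw [AdicCompletion.evalₐ_mapRingHom, AdicCompletion.evalₐ_algebraMap,
    AdicCompletion.evalₐ_algebraMap, Ideal.quotientMap_mk]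

/-- The kernel of the projection of the completion onto `R / Iⁿ` is the `n`-th power of the
extension of `I`, so that the powers of this extension are closed; here `I` has to be finitely
generated. -/
theorem AdicCompletion.ker_evalₐ {R : Type*} [CommRing R] {I : Ideal R} (hI : I.FG) (n : ℕ) :
    RingHom.ker (AdicCompletion.evalₐ I n) = (I.map (algebraMap R (AdicCompletion I R))) ^ n := by
  ext x
  have h1 := AdicCompletion.pow_smul_top_eq_ker_eval (I := I) (M := R) (n := n) hI
  rw [Ideal.smul_top_eq_map, Ideal.map_pow] at h1
  have h2 : x ∈ (I.map (algebraMap R (AdicCompletion I R))) ^ n ↔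
      x ∈ (AdicCompletion.eval I R n).ker := by
    rw [← h1]; rfl
  rw [h2, LinearMap.mem_ker, RingHom.mem_ker]
  have h3 : (I ^ n • ⊤ : Ideal R) = I ^ n := by simp
  exact (Ideal.quotientEquivAlgOfEq R h3).map_eq_zero_iff

/-- The induced map is surjective modulo the extension of `I`, and completeness of the source and
separatedness of the target lift this to surjectivity. -/
theorem AdicCompletion.mapRingHom_surjective {R S : Type*} [CommRing R] [CommRing S] {I : Ideal R}
    {J : Ideal S} {g : R →+* S} (hI : I.FG) (hIJ : I.map g = J) (hg : Function.Surjective g) :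
    Function.Surjective (AdicCompletion.mapRingHom I J g (Ideal.map_le_iff_le_comap.1 hIJ.le)) := by
  have hJ : J.FG := hIJ ▸ hI.map g
  have h1 := AdicCompletion.isAdicComplete_self I hI
  have h2 := AdicCompletion.isAdicComplete_self J hJ
  set Φ := AdicCompletion.mapRingHom I J g (Ideal.map_le_iff_le_comap.1 hIJ.le)
  have hΦ : Φ.comp (algebraMap R _) = (algebraMap S _).comp g :=
    RingHom.ext (AdicCompletion.mapRingHom_algebraMap I J g (Ideal.map_le_iff_le_comap.1 hIJ.le))
  have h3 : (I.map (algebraMap R (AdicCompletion I R))).map Φ = J.map (algebraMap S _) := by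
    rw [Ideal.map_map, hΦ, ← Ideal.map_map, hIJ]
  have : IsHausdorff ((I.map (algebraMap R (AdicCompletion I R))).map Φ) (AdicCompletion J S) := by
    rw [h3]; infer_instance
  refine surjective_of_mk_map_comp_surjective (I := I.map (algebraMap R (AdicCompletion I R))) Φ ?_
  intro y
  obtain ⟨y, rfl⟩ := Ideal.Quotient.mk_surjective y
  obtain ⟨s, hs⟩ := Ideal.Quotient.mk_surjective (AdicCompletion.evalₐ J 1 y)
  obtain ⟨r, rfl⟩ := hg s
  refine ⟨algebraMap R _ r, ?_⟩
  rw [RingHom.comp_apply, Ideal.Quotient.mk_eq_mk_iff_sub_mem, h3,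
    AdicCompletion.mapRingHom_algebraMap, ← pow_one (J.map _), ← AdicCompletion.ker_evalₐ hJ,
    RingHom.mem_ker, map_sub, AdicCompletion.evalₐ_algebraMap, hs, sub_self]

theorem AdicCompletion.isNoetherianRing_mvPolynomial (R σ : Type*) [CommRing R]
    [IsNoetherianRing R] [Finite σ] :
    IsNoetherianRing (AdicCompletion (MvPolynomial.idealOfVars σ R) (MvPolynomial σ R)) :=
  isNoetherianRing_of_ringEquiv _ (MvPowerSeries.toAdicCompletionAlgEquiv σ R).toRingEquiv

/-- The completion of a Noetherian ring is Noetherian, as a quotient of a power series ring. -/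
instance AdicCompletion.isNoetherianRing {R : Type*} [CommRing R] [IsNoetherianRing R]
    (I : Ideal R) : IsNoetherianRing (AdicCompletion I R) := by
  obtain ⟨n, a, ha⟩ := Submodule.fg_iff_exists_fin_generating_family.1 (IsNoetherian.noetherian I)
  have hI : (MvPolynomial.idealOfVars (Fin n) R).map
      (MvPolynomial.aeval a : MvPolynomial (Fin n) R →ₐ[R] R).toRingHom = I := by
    rw [MvPolynomial.idealOfVars, Ideal.map_span, ← Set.range_comp, ← ha]
    congr 2
    ext i
    simp
  have := AdicCompletion.isNoetherianRing_mvPolynomial R (Fin n)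
  exact isNoetherianRing_of_surjective _ _ _ (AdicCompletion.mapRingHom_surjective
    (MvPolynomial.idealOfVars_fg _ _) hI fun r => ⟨MvPolynomial.C r, by simp⟩)

/-! ### Complete intersections -/

/-- The completion of a regular local ring is regular: flatness gives going down, so the dimension
does not drop. -/
instance AdicCompletion.isRegularLocalRing (R : Type*) [CommRing R] [IsRegularLocalRing R] :
    IsRegularLocalRing (AdicCompletion (maximalIdeal R) R) := by
  refine IsRegularLocalRing.of_spanFinrank_maximalIdeal_le _ ?_
  rw [AdicCompletion.spanFinrank_maximalIdeal_eq, IsRegularLocalRing.spanFinrank_maximalIdeal,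
    ← maximalIdeal_height_eq_ringKrullDim, ← maximalIdeal_height_eq_ringKrullDim]
  have : (maximalIdeal (AdicCompletion (maximalIdeal R) R)).LiesOver (maximalIdeal R) :=
    ⟨(maximalIdeal_comap (algebraMap R (AdicCompletion (maximalIdeal R) R))).symm⟩
  rw [Ideal.height_eq_height_add_of_liesOver_of_hasGoingDown (maximalIdeal R)
    (maximalIdeal (AdicCompletion (maximalIdeal R) R))]
  exact_mod_cast le_self_add

/-- **Krull**: every ideal of a Noetherian local ring is closed in the adic topology. -/
theorem Ideal.mem_of_forall_mem_sup_maximalIdeal_pow {R : Type*} [CommRing R] [IsLocalRing R]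
    [IsNoetherianRing R] (J : Ideal R) {x : R} (h : ∀ n, x ∈ J ⊔ maximalIdeal R ^ n) : x ∈ J := by
  have : IsHausdorff (maximalIdeal R) (R ⧸ J) := inferInstance
  rw [← Ideal.Quotient.eq_zero_iff_mem]
  refine this.haus' _ fun n => ?_
  rw [SModEq.zero]
  obtain ⟨j, hj, y, hy, rfl⟩ := Submodule.mem_sup.1 (h n)
  rw [map_add, Ideal.Quotient.eq_zero_iff_mem.2 hj, zero_add]
  have : Ideal.Quotient.mk J y = y • (1 : R ⧸ J) := by
    rw [Algebra.smul_def, mul_one]; rfl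
  rw [this]
  exact Submodule.smul_mem_smul hy trivial

/-- A regular local ring modulo a regular sequence is a complete intersection: completion is exact,
so the completion of the quotient is the completed ring modulo the same sequence. -/
theorem isCompleteIntersectionLocalRing_of_surjective {R C : Type u} [CommRing R]
    [IsRegularLocalRing R] [CommRing C] [IsLocalRing C] (π : R →+* C)
    (hπ : Function.Surjective π) (rs : List R) (hrs : RingTheory.Sequence.IsRegular R rs)
    (hker : RingHom.ker π = Ideal.ofList rs) : IsCompleteIntersectionLocalRing C := by
  have hC : IsNoetherianRing C := isNoetherianRing_of_surjective _ _ π hπ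
  have hm : (maximalIdeal R).map π = maximalIdeal C := map_maximalIdeal_of_surjective π hπ
  refine ⟨hC, AdicCompletion (maximalIdeal R) R, inferInstance, inferInstance,
    rs.map (algebraMap R _), ?_, ?_⟩
  · have hmem : ∀ r ∈ rs, r ∈ maximalIdeal R := fun r hr => by
      refine le_maximalIdeal (J := Ideal.ofList rs) (fun h => hrs.top_ne_smul ?_)
        (Ideal.subset_span hr)
      rw [h]; simp
    refine (IsLocalRing.isRegular_iff_isWeaklyRegular_of_subset_maximalIdeal (fun r hr => ?_)).2
      hrs.1.of_flat
    obtain ⟨r, hr', rfl⟩ := List.mem_map.1 hr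
    rw [AdicCompletion.maximalIdeal_eq_map]
    exact Ideal.mem_map_of_mem _ (hmem r hr')
  · have hfg : (maximalIdeal R).FG := IsNoetherian.noetherian _
    have hle := Ideal.map_le_iff_le_comap.1 hm.le
    have hsurj := AdicCompletion.mapRingHom_surjective hfg hm hπ
    rw [← Ideal.map_ofList, ← hker]
    have hkerΦ : RingHom.ker (AdicCompletion.mapRingHom (maximalIdeal R) (maximalIdeal C) π hle) =
        (RingHom.ker π).map (algebraMap R (AdicCompletion (maximalIdeal R) R)) := by
      refine le_antisymm (fun x hx => ?_) (Ideal.map_le_iff_le_comap.2 fun x hx => ?_)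
      · refine Ideal.mem_of_forall_mem_sup_maximalIdeal_pow _ fun n => ?_
        have h1 : AdicCompletion.evalₐ (maximalIdeal C) n
            (AdicCompletion.mapRingHom _ _ π hle x) = 0 := by rw [(RingHom.mem_ker).1 hx, map_zero]
        obtain ⟨y, hy⟩ := Ideal.Quotient.mk_surjective (AdicCompletion.evalₐ (maximalIdeal R) n x)
        rw [AdicCompletion.evalₐ_mapRingHom, ← hy, Ideal.quotientMap_mk,
          Ideal.Quotient.eq_zero_iff_mem, ← hm, ← Ideal.map_pow,
          Ideal.mem_map_iff_of_surjective π hπ] at h1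
        obtain ⟨z, hz, hzy⟩ := h1
        have h2 : y - z ∈ RingHom.ker π := by rw [RingHom.mem_ker, map_sub, hzy, sub_self]
        have h3 : x - algebraMap R _ y ∈ maximalIdeal (AdicCompletion (maximalIdeal R) R) ^ n := by
          rw [AdicCompletion.maximalIdeal_eq_map, ← AdicCompletion.ker_evalₐ hfg, RingHom.mem_ker,
            map_sub, AdicCompletion.evalₐ_algebraMap, hy, sub_self]
        have h4 : algebraMap R _ z ∈ maximalIdeal (AdicCompletion (maximalIdeal R) R) ^ n := by
          rw [AdicCompletion.maximalIdeal_eq_map, ← Ideal.map_pow]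
          exact Ideal.mem_map_of_mem _ hz
        have h5 : x = algebraMap R _ (y - z) + (algebraMap R _ z + (x - algebraMap R _ y)) := by
          rw [map_sub]; ring
        rw [h5]
        exact Submodule.add_mem_sup (Ideal.mem_map_of_mem _ h2) (add_mem h4 h3)
      · rw [Ideal.mem_comap, RingHom.mem_ker, AdicCompletion.mapRingHom_algebraMap,
          (RingHom.mem_ker).1 hx, map_zero]
    rw [← hkerΦ]
    exact ⟨(RingHom.quotientKerEquivOfSurjective hsurj).symm⟩

/-- A regular ring modulo a regular sequence is a complete intersection. -/
theorem isCompleteIntersectionRing_of_surjective {R C : Type u} [CommRing R] [IsRegularRing R]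
    [CommRing C] (π : R →+* C) (hπ : Function.Surjective π) (rs : List R)
    (hrs : RingTheory.Sequence.IsWeaklyRegular R rs) (hker : RingHom.ker π = Ideal.ofList rs) :
    IsCompleteIntersectionRing C := by
  refine ⟨isNoetherianRing_of_surjective _ _ π hπ, fun p _ => ?_⟩
  let q := p.comap π
  have hmem : ∀ r ∈ rs, r ∈ q := fun r hr => by
    have : r ∈ RingHom.ker π := hker ▸ Ideal.subset_span hr
    rw [Ideal.mem_comap, (RingHom.mem_ker).1 this]; exact p.zero_mem
  refine isCompleteIntersectionLocalRing_of_surjective (Localization.localRingHom q p π rfl)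
    (fun x => ?_) (rs.map (algebraMap R (Localization.AtPrime q)))
    (hrs.isRegular_of_isLocalization_of_mem _ q hmem) ?_
  · obtain ⟨a, s, rfl⟩ := IsLocalization.exists_mk'_eq p.primeCompl x
    obtain ⟨b, rfl⟩ := hπ a
    obtain ⟨t, ht⟩ := hπ s
    have htq : t ∈ q.primeCompl := fun h => s.2 (by simpa [q, ht] using h)
    refine ⟨IsLocalization.mk' _ b (⟨t, htq⟩ : q.primeCompl), ?_⟩
    rw [Localization.localRingHom_mk']
    congr 1
    exact Subtype.ext ht
  · rw [← Ideal.map_ofList, ← hker]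
    refine le_antisymm (fun x hx => ?_) (Ideal.map_le_iff_le_comap.2 fun x hx => ?_)
    · obtain ⟨a, s, rfl⟩ := IsLocalization.exists_mk'_eq q.primeCompl x
      rw [RingHom.mem_ker, Localization.localRingHom_mk', IsLocalization.mk'_eq_zero_iff] at hx
      obtain ⟨t, ht⟩ := hx
      obtain ⟨t', ht'⟩ := hπ t
      have htq : t' ∈ q.primeCompl := fun h => t.2 (by simpa [q, ht'] using h)
      rw [← ht', ← map_mul] at ht
      have h1 : algebraMap R (Localization.AtPrime q) (t' * a) ∈
          (RingHom.ker π).map (algebraMap R (Localization.AtPrime q)) := Ideal.mem_map_of_mem _ ht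
      rw [map_mul] at h1
      have h2 := (Ideal.unit_mul_mem_iff_mem _
        (IsLocalization.map_units (Localization.AtPrime q) ⟨t', htq⟩)).1 h1
      rw [← IsLocalization.mk'_spec (Localization.AtPrime q) a s, mul_comm] at h2
      exact (Ideal.unit_mul_mem_iff_mem _ (IsLocalization.map_units _ s)).1 h2
    · rw [Ideal.mem_comap, RingHom.mem_ker, Localization.localRingHom_to_map,
        (RingHom.mem_ker).1 hx, map_zero]

/-! ### Depth and associated primes -/

open scoped Pointwise in
/-- If `x` is regular on `M`, every associated prime `q` of `M` lies strictly below some associated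
prime of `M / xM`: by Nakayama, the submodule of `M` killed by `q` is not contained in `xM`. -/
theorem exists_isAssociatedPrime_quotSMulTop {R M : Type*} [CommRing R] [IsNoetherianRing R]
    [IsLocalRing R] [AddCommGroup M] [Module R M] [Module.Finite R M] {x : R}
    (hx : x ∈ maximalIdeal R) (hreg : IsSMulRegular M x) {q : Ideal R}
    (hq : IsAssociatedPrime q M) :
    ∃ q' : Ideal R, IsAssociatedPrime q' (QuotSMulTop x M) ∧ q ≤ q' ∧ x ∈ q' := by
  obtain ⟨hqp, m, hm⟩ := isAssociatedPrime_iff.1 hq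
  have hm0 : m ≠ 0 := by
    rintro rfl
    refine hqp.ne_top ((Ideal.eq_top_iff_one _).2 ?_)
    rw [hm]; simp
  have hqm : ∀ a ∈ q, a • m = 0 := fun a ha => by
    rw [hm] at ha; simpa using ha
  let N : Submodule R M := Submodule.torsionBySet R M (q : Set R)
  have hmN : m ∈ N := (Submodule.mem_torsionBySet_iff _ _).2 fun a => hqm a a.2
  -- Otherwise `N = x N`, since `x z ∈ N` implies `z ∈ N`.
  obtain ⟨y, hyN, hy⟩ : ∃ y ∈ N, y ∉ x • (⊤ : Submodule R M) := by
    by_contra! hcon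
    have hle : N ≤ maximalIdeal R • N := fun y hy => by
      obtain ⟨z, -, rfl⟩ := (Submodule.mem_smul_pointwise_iff_exists _ _ _).1 (hcon y hy)
      refine Submodule.smul_mem_smul hx ((Submodule.mem_torsionBySet_iff _ _).2 fun a => hreg ?_)
      have := (Submodule.mem_torsionBySet_iff _ _).1 hy a
      change x • (a : R) • z = x • (0 : M)
      rw [smul_zero, smul_comm]
      exact this
    have : N = ⊥ := Submodule.eq_bot_of_le_smul_of_le_jacobson_bot _ N (IsNoetherian.noetherian N)
      hle (maximalIdeal_le_jacobson _)
    rw [this] at hmN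
    exact hm0 hmN
  have hy0 : (Submodule.Quotient.mk y : QuotSMulTop x M) ≠ 0 := fun h =>
    hy ((Submodule.Quotient.mk_eq_zero _).1 h)
  obtain ⟨q', hq', hle⟩ := exists_le_isAssociatedPrime_of_isNoetherianRing R
    (Submodule.Quotient.mk y : QuotSMulTop x M) hy0
  refine ⟨q', hq', fun a ha => hle ?_, hle ?_⟩
  · have : a • y = 0 := (Submodule.mem_torsionBySet_iff _ _).1 hyN ⟨a, ha⟩
    simp [← Submodule.Quotient.mk_smul, this]
  · have : x • y ∈ x • (⊤ : Submodule R M) := Submodule.smul_mem_pointwise_smul _ _ _ trivial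
    simpa [← Submodule.Quotient.mk_smul] using (Submodule.Quotient.mk_eq_zero _).2 this

theorem ringKrullDim_quotient_add_one_le {R : Type*} [CommRing R] {q q' : Ideal R} [q.IsPrime]
    (h : q ≤ q') {x : R} (hx : x ∈ q') (hxq : x ∉ q) :
    ringKrullDim (R ⧸ q') + 1 ≤ ringKrullDim (R ⧸ q) := by
  have h1 : (Ideal.Quotient.mk q x) ∈ nonZeroDivisors (R ⧸ q) :=
    mem_nonZeroDivisors_of_ne_zero fun h0 => hxq (Ideal.Quotient.eq_zero_iff_mem.1 h0)
  refine le_trans ?_ (ringKrullDim_quotient_succ_le_of_nonZeroDivisor h1)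
  have h2 : ringKrullDim (R ⧸ q') ≤
      ringKrullDim ((R ⧸ q) ⧸ Ideal.span {Ideal.Quotient.mk q x}) :=
    ringKrullDim_le_of_surjective (Ideal.Quotient.lift _ (Ideal.Quotient.factor h) (by
      intro a ha
      have : Ideal.span {Ideal.Quotient.mk q x} ≤ RingHom.ker (Ideal.Quotient.factor h) := by
        rw [Ideal.span_singleton_le_iff_mem, RingHom.mem_ker, Ideal.Quotient.factor_mk]
        exact Ideal.Quotient.eq_zero_iff_mem.2 hx
      exact this ha))
      (Ideal.Quotient.lift_surjective_of_surjective _ _ (Ideal.Quotient.factor_surjective h))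
  gcongr

/-- A module with a regular sequence of length `t` has no associated prime of dimension less
than `t`. -/
theorem length_le_ringKrullDim_quotient_of_isAssociatedPrime {R M : Type*} [CommRing R]
    [IsNoetherianRing R] [IsLocalRing R] [AddCommGroup M] [Module R M] [Module.Finite R M]
    (rs : List R) (hmem : ∀ r ∈ rs, r ∈ maximalIdeal R)
    (hrs : RingTheory.Sequence.IsWeaklyRegular M rs) {q : Ideal R} (hq : IsAssociatedPrime q M) :
    (rs.length : WithBot ℕ∞) ≤ ringKrullDim (R ⧸ q) := by
  induction rs generalizing M q with
  | nil =>
    have := hq.isPrime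
    simpa using ringKrullDim_nonneg_of_nontrivial
  | cons x rs ih =>
    rw [RingTheory.Sequence.isWeaklyRegular_cons_iff] at hrs
    obtain ⟨q', hq', hle, hx⟩ :=
      exists_isAssociatedPrime_quotSMulTop (hmem x (by simp)) hrs.1 hq
    have h1 := ih (fun r hr => hmem r (by simp [hr])) hrs.2 hq'
    have hqp := hq.isPrime
    have hxq : x ∉ q := fun hxq => by
      obtain ⟨-, m, hm⟩ := isAssociatedPrime_iff.1 hq
      rw [hm] at hxq
      have h0 : x • m = x • (0 : M) := by simpa using hxq
      have h0' : m = 0 := hrs.1 h0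
      refine hqp.ne_top ((Ideal.eq_top_iff_one _).2 ?_)
      rw [hm, h0']; simp
    refine le_trans ?_ (ringKrullDim_quotient_add_one_le hle hx hxq)
    rw [List.length_cons]
    push_cast
    gcongr

open CategoryTheory CategoryTheory.Abelian in
/-- Dividing by an arbitrary regular element drops the depth by at most one, by the long exact
sequence of `Ext` and the theorem of Rees. -/
theorem exists_isRegular_quotSMulTop {R M : Type u} [CommRing R] [IsNoetherianRing R]
    [IsLocalRing R] [AddCommGroup M] [Module R M] [Module.Finite R M] [Nontrivial M] (t : ℕ)
    (h : ∃ rs : List R, rs.length = t + 1 ∧ (∀ r ∈ rs, r ∈ maximalIdeal R) ∧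
      RingTheory.Sequence.IsRegular M rs) {y : R} (hy : y ∈ maximalIdeal R)
    (hreg : IsSMulRegular M y) :
    ∃ rs : List R, rs.length = t ∧ (∀ r ∈ rs, r ∈ maximalIdeal R) ∧
      RingTheory.Sequence.IsRegular (QuotSMulTop y M) rs := by
  have : Nontrivial (QuotSMulTop y M) := nontrivial_quotSMulTop_of_mem_maximalIdeal M hy
  have hlt : ∀ (M' : Type u) [AddCommGroup M'] [Module R M'] [Module.Finite R M'] [Nontrivial M'],
      maximalIdeal R • (⊤ : Submodule R M') < ⊤ := fun M' _ _ _ _ =>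
    lt_top_iff_ne_top.2 fun h => by
      have := Submodule.eq_bot_of_le_smul_of_le_jacobson_bot _ ⊤ Module.Finite.fg_top
        (h.ge : (⊤ : Submodule R M') ≤ maximalIdeal R • ⊤) (maximalIdeal_le_jacobson _)
      exact top_ne_bot this
  have T₁ := (ModuleCat.exists_isRegular_tfae (maximalIdeal R) (t + 1) (ModuleCat.of R M)
    (hlt M)).out 1 3
  have T₂ := (ModuleCat.exists_isRegular_tfae (maximalIdeal R) t (ModuleCat.of R (QuotSMulTop y M))
    (hlt _)).out 1 3
  refine T₂.1 fun i hi => ?_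
  have H := T₁.2 h
  have zero1 := AddCommGrpCat.isZero_of_iff_subsingleton.mpr (H i (by omega))
  have zero2 := AddCommGrpCat.isZero_of_iff_subsingleton.mpr (H (i + 1) (by omega))
  exact AddCommGrpCat.subsingleton_of_isZero <| ShortComplex.Exact.isZero_of_both_zeros
    (Ext.covariant_sequence_exact₃' _
      (IsSMulRegular.smulShortComplex_shortExact (M := ModuleCat.of R M) hreg) i (i + 1) rfl)
    (zero1.eq_zero_of_src _) (zero2.eq_zero_of_tgt _)

/-- Unmixedness: modulo a regular sequence of length `j`, a module of depth at least `n` has no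
associated prime of dimension below `n - j`. -/
theorem le_ringKrullDim_quotient_add_length {R M : Type u} [CommRing R] [IsNoetherianRing R]
    [IsLocalRing R] [AddCommGroup M] [Module R M] [Module.Finite R M] [Nontrivial M] (n : ℕ)
    (h : ∃ rs : List R, rs.length = n ∧ (∀ r ∈ rs, r ∈ maximalIdeal R) ∧
      RingTheory.Sequence.IsRegular M rs) (fs : List R) (hfs : ∀ f ∈ fs, f ∈ maximalIdeal R)
    (hreg : RingTheory.Sequence.IsWeaklyRegular M fs) {q : Ideal R}
    (hq : IsAssociatedPrime q (M ⧸ (Ideal.ofList fs • ⊤ : Submodule R M))) :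
    (n : WithBot ℕ∞) ≤ ringKrullDim (R ⧸ q) + fs.length := by
  induction fs generalizing M n with
  | nil =>
    obtain ⟨rs, hlen, hmem, hrs⟩ := h
    have e : (M ⧸ (Ideal.ofList ([] : List R) • ⊤ : Submodule R M)) ≃ₗ[R] M :=
      Submodule.quotEquivOfEqBot _ (by simp)
    have := length_le_ringKrullDim_quotient_of_isAssociatedPrime rs hmem hrs.1
      ((LinearEquiv.isAssociatedPrime_iff e).1 hq)
    simpa [hlen] using this
  | cons f fs ih =>
    rw [RingTheory.Sequence.isWeaklyRegular_cons_iff] at hreg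
    have := hq.isPrime
    have h0 : (0 : WithBot ℕ∞) ≤ ringKrullDim (R ⧸ q) := ringKrullDim_nonneg_of_nontrivial
    rcases n with _ | n
    · simp only [Nat.cast_zero]
      positivity
    · have hf := hfs f (by simp)
      have : Nontrivial (QuotSMulTop f M) := nontrivial_quotSMulTop_of_mem_maximalIdeal M hf
      have h1 := ih (M := QuotSMulTop f M) n (exists_isRegular_quotSMulTop n h hf hreg.1)
        (fun g hg => hfs g (by simp [hg])) hreg.2 ((LinearEquiv.isAssociatedPrime_iff
          (Submodule.quotOfListConsSMulTopEquivQuotSMulTopInner M f fs)).1 hq)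
      rw [List.length_cons]
      push_cast
      rw [← add_assoc]
      gcongr

/-! ### Homogeneous ideals of polynomial rings -/

attribute [local instance] MvPolynomial.gradedAlgebra

namespace MvPolynomial

variable {σ k : Type*} [Field k]

theorem isHomogeneous_ideal_of_homogeneousComponent_mem {I : Ideal (MvPolynomial σ k)}
    (h : ∀ p ∈ I, ∀ n, homogeneousComponent n p ∈ I) :
    I.IsHomogeneous (homogeneousSubmodule σ k) := by
  intro i p hp
  have := h p hp i
  rwa [← decomposition.decompose'_apply] at this

theorem isHomogeneous_ofList {Fs : List (MvPolynomial σ k)}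
    (h : ∀ F ∈ Fs, ∃ i, F.IsHomogeneous i) :
    (Ideal.ofList Fs).IsHomogeneous (homogeneousSubmodule σ k) :=
  Ideal.homogeneous_span _ _ fun F hF => h F hF

theorem exists_isHomogeneous_mem_notMem {Q p : Ideal (MvPolynomial σ k)}
    (hQ : Q.IsHomogeneous (homogeneousSubmodule σ k)) (h : ¬ Q ≤ p) :
    ∃ (i : ℕ) (F : MvPolynomial σ k), F.IsHomogeneous i ∧ F ∈ Q ∧ F ∉ p := by
  by_contra! hcon
  refine h fun F hF => ?_
  rw [← sum_homogeneousComponent F]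
  exact Ideal.sum_mem _ fun i _ => hcon i _ (homogeneousComponent_isHomogeneous i F)
    (homogeneousComponent_mem_of_mem hQ hF i)

theorem IsHomogeneous.eq_zero_of_mem_idealOfVars {F : MvPolynomial σ k} (hF : F.IsHomogeneous 0)
    (h : F ∈ idealOfVars σ k) : F = 0 := by
  have h1 : F ∈ idealOfVars σ k ^ 1 := by rwa [pow_one]
  rw [mem_pow_idealOfVars_iff'] at h1
  ext d
  rw [coeff_zero]
  by_cases hd : d.degree = 0
  · exact h1 d (by omega)
  · exact hF.coeff_eq_zero hd

/-- **Homogeneous prime avoidance.** One removes a minimal member `p` of the finite set `s`, avoids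
the others by some `F`, and adds to a power of `F` a power of an element lying in all of them but
not in `p`, the exponents making the sum homogeneous. -/
theorem exists_isHomogeneous_mem_forall_notMem {Q : Ideal (MvPolynomial σ k)}
    (hQ : Q.IsHomogeneous (homogeneousSubmodule σ k)) (hQM : Q ≤ idealOfVars σ k)
    (s : Finset (Ideal (MvPolynomial σ k)))
    (hs : ∀ p ∈ s, p.IsPrime ∧ p.IsHomogeneous (homogeneousSubmodule σ k) ∧ ¬ Q ≤ p) :
    ∃ (i : ℕ) (F : MvPolynomial σ k), F.IsHomogeneous i ∧ F ∈ Q ∧ ∀ p ∈ s, F ∉ p := by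
  classical
  induction s using Finset.strongInduction with
  | H s ih =>
    rcases s.eq_empty_or_nonempty with rfl | hne
    · exact ⟨0, 0, isHomogeneous_zero _ _ _, Q.zero_mem, by simp⟩
    obtain ⟨p, hpmin⟩ := s.exists_minimal hne
    obtain ⟨hps, hpmin⟩ := hpmin
    obtain ⟨hpp, hph, hpQ⟩ := hs p hps
    obtain ⟨i, F, hFi, hFQ, hF⟩ := ih (s.erase p) (Finset.erase_ssubset hps)
      fun p' hp' => hs p' (Finset.mem_of_mem_erase hp')
    by_cases hFp : F ∈ p
    swap
    · refine ⟨i, F, hFi, hFQ, fun p' hp' => ?_⟩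
      by_cases h : p' = p
      · rwa [h]
      · exact hF p' (Finset.mem_erase.2 ⟨h, hp'⟩)
    -- By minimality of `p`, no other member of `s` is contained in `p`.
    have hprod : ¬ Q * ∏ p' ∈ s.erase p, p' ≤ p := fun h => by
      rcases hpp.mul_le.1 h with h | h
      · exact hpQ h
      · obtain ⟨p', hp', hle⟩ := (Ideal.IsPrime.prod_le hpp).1 h
        obtain ⟨h1, h2⟩ := Finset.mem_erase.1 hp'
        exact h1 (le_antisymm hle (hpmin h2 hle))
    have hhom : (Q * ∏ p' ∈ s.erase p, p').IsHomogeneous (homogeneousSubmodule σ k) := by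
      refine hQ.mul ?_
      refine Finset.prod_induction _ (fun J : Ideal (MvPolynomial σ k) =>
        J.IsHomogeneous (homogeneousSubmodule σ k))
        (fun _ _ => Ideal.IsHomogeneous.mul) ?_
        fun p' hp' => (hs p' (Finset.mem_of_mem_erase hp')).2.1
      rw [Ideal.one_eq_top]; exact Ideal.IsHomogeneous.top _
    obtain ⟨j, G, hGj, hG, hGp⟩ := exists_isHomogeneous_mem_notMem (p := p) hhom hprod
    have hle : Q * ∏ p' ∈ s.erase p, p' ≤ Q ⊓ (s.erase p).inf id :=
      Ideal.mul_le_inf.trans (inf_le_inf_left _ Ideal.prod_le_inf)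
    obtain ⟨hGQ, hG'⟩ := Submodule.mem_inf.1 (hle hG)
    have hGs : ∀ p' ∈ s.erase p, G ∈ p' := fun p' hp' => Finset.inf_le (f := id) hp' hG'
    -- Forms of degree zero in `Q` vanish, so that the exponents `j` and `i` below are positive.
    rcases Nat.eq_zero_or_pos i with rfl | hi
    · have hF0 := hFi.eq_zero_of_mem_idealOfVars (hQM hFQ)
      refine ⟨j, G, hGj, hGQ, fun p' hp' => ?_⟩
      by_cases h : p' = p
      · rwa [h]
      · exact absurd (hF0 ▸ p'.zero_mem) (hF p' (Finset.mem_erase.2 ⟨h, hp'⟩))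
    have hj : j ≠ 0 := by
      rintro rfl
      rw [hGj.eq_zero_of_mem_idealOfVars (hQM hGQ)] at hGp
      exact hGp p.zero_mem
    refine ⟨i * j, F ^ j + G ^ i, (hFi.pow j).add (mul_comm j i ▸ hGj.pow i),
      Q.add_mem (Q.pow_mem_of_mem hFQ j (Nat.pos_of_ne_zero hj)) (Q.pow_mem_of_mem hGQ i hi),
      fun p' hp' hmem => ?_⟩
    by_cases h : p' = p
    · subst h
      have := (Ideal.add_mem_iff_right _ (p'.pow_mem_of_mem hFp j (Nat.pos_of_ne_zero hj))).1 hmem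
      exact hGp (hpp.mem_of_pow_mem i this)
    · have hp'' := Finset.mem_erase.2 ⟨h, hp'⟩
      have := (Ideal.add_mem_iff_left _ (p'.pow_mem_of_mem (hGs p' hp'') i hi)).1 hmem
      exact hF p' hp'' ((hs p' hp').1.mem_of_pow_mem j this)

theorem X_mem_idealOfVars (i : σ) : (X i : MvPolynomial σ k) ∈ idealOfVars σ k :=
  Ideal.subset_span ⟨i, rfl⟩

instance isMaximal_idealOfVars : (idealOfVars σ k).IsMaximal := by
  have h : idealOfVars σ k = RingHom.ker (constantCoeff : MvPolynomial σ k →+* k) := by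
    ext p
    rw [← pow_one (idealOfVars σ k), mem_pow_idealOfVars_iff', RingHom.mem_ker,
      constantCoeff_eq]
    refine ⟨fun h => h 0 (by simp), fun h x hx => ?_⟩
    have : x = 0 := by
      rw [← Finsupp.degree_eq_zero_iff]; omega
    rw [this, h]
  rw [h]
  exact RingHom.ker_isMaximal_of_surjective _ fun a => ⟨C a, by simp⟩

/-- The variables form a weakly regular sequence. -/
theorem isWeaklyRegular_X (n : ℕ) : RingTheory.Sequence.IsWeaklyRegular (MvPolynomial (Fin n) k)
    (List.ofFn (X : Fin n → MvPolynomial (Fin n) k)) := by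
  refine ⟨fun i hi => ?_⟩
  rw [List.length_ofFn] at hi
  have hI : (Ideal.ofList ((List.ofFn (X : Fin n → MvPolynomial (Fin n) k)).take i) • ⊤ :
      Ideal (MvPolynomial (Fin n) k)) = Ideal.span (X '' {j : Fin n | (j : ℕ) < i}) := by
    rw [smul_eq_mul, Ideal.mul_top]
    refine congrArg Ideal.span ?_
    ext F
    change F ∈ List.take i (List.ofFn X) ↔ _
    simp only [List.mem_take_iff_getElem, Set.mem_image, List.getElem_ofFn, List.length_ofFn]
    constructor
    · rintro ⟨j, hj, rfl⟩
      have hj' := lt_min_iff.1 hj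
      exact ⟨⟨j, by simpa using hj'.2⟩, hj'.1, rfl⟩
    · rintro ⟨j, hj, rfl⟩
      exact ⟨j, lt_min hj (by simp), rfl⟩
  rw [isSMulRegular_quotient_iff_mem_of_smul_mem, hI]
  intro F hF
  rw [List.getElem_ofFn, smul_eq_mul, mem_ideal_span_X_image] at hF
  rw [mem_ideal_span_X_image]
  intro m hm
  obtain ⟨j, hj, hj0⟩ := hF (Finsupp.single ⟨i, hi⟩ 1 + m) (by
    rw [mem_support_iff, coeff_X_mul]; exact mem_support_iff.1 hm)
  refine ⟨j, hj, ?_⟩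
  have hne : (⟨i, hi⟩ : Fin n) ≠ j := by
    rintro rfl
    simp at hj
  rwa [Finsupp.add_apply, Finsupp.single_eq_of_ne hne.symm, zero_add] at hj0

theorem homogeneousComponent_mul_of_isHomogeneous {F z : MvPolynomial σ k} {i : ℕ}
    (hF : F.IsHomogeneous i) (e : ℕ) :
    homogeneousComponent (i + e) (F * z) = F * homogeneousComponent e z := by
  conv_lhs => rw [← sum_homogeneousComponent z, Finset.mul_sum, map_sum]
  rw [Finset.sum_eq_single e]
  · exact homogeneousComponent_eq_self (hF.mul (homogeneousComponent_isHomogeneous e z))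
  · intro b _ hb
    rw [homogeneousComponent_of_mem (hF.mul (homogeneousComponent_isHomogeneous b z)),
      if_neg (by omega)]
  · intro he
    rw [homogeneousComponent_eq_zero e z (by simpa using he), mul_zero, map_zero]

/-- A homogeneous ideal is determined by its localization at the origin: if `t z ∈ I` with `z`
homogeneous and `t` a unit at the origin, then comparing components gives `t₀ z ∈ I`. -/
theorem mem_of_mul_mem_of_notMem_idealOfVars {I : Ideal (MvPolynomial σ k)}
    (hI : I.IsHomogeneous (homogeneousSubmodule σ k)) {z t : MvPolynomial σ k} {e : ℕ}
    (hz : z.IsHomogeneous e) (ht : t ∉ idealOfVars σ k) (h : t * z ∈ I) : z ∈ I := by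
  have h1 := homogeneousComponent_mem_of_mem hI h (e + 0)
  rw [mul_comm, homogeneousComponent_mul_of_isHomogeneous hz, homogeneousComponent_zero,
    mul_comm] at h1
  have h0 : coeff 0 t ≠ 0 := fun h0 => ht (by
    rw [← pow_one (idealOfVars σ k), mem_pow_idealOfVars_iff']
    intro x hx
    have : x = 0 := by
      rw [← Finsupp.degree_eq_zero_iff]; omega
    rw [this, h0])
  have h2 := I.mul_mem_left (C (coeff 0 t)⁻¹) h1
  rwa [← mul_assoc, ← C_mul, inv_mul_cancel₀ h0, C_1, one_mul] at h2

end MvPolynomial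

/-! ### Regular sequences of forms -/

/-- Contracting chains of primes of a localization `S` of `R` preserves strict inclusions. -/
theorem ringKrullDim_quotient_le_comap_algebraMap {R S : Type*} [CommRing R] [CommRing S]
    [Algebra R S] (T : Submonoid R) [IsLocalization T S] (q : Ideal S) :
    ringKrullDim (S ⧸ q) ≤ ringKrullDim (R ⧸ q.comap (algebraMap R S)) := by
  rw [ringKrullDim_quotient, ringKrullDim_quotient]
  refine Order.krullDim_le_of_strictMono (fun x => ⟨PrimeSpectrum.comap (algebraMap R S) x.1,
    fun y hy => x.2 hy⟩) fun x y hxy => ?_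
  have hinj := PrimeSpectrum.localization_comap_injective S T
  refine lt_of_le_of_ne (Ideal.comap_mono (le_of_lt hxy)) fun h => hxy.ne ?_
  exact Subtype.ext (hinj (congrArg Subtype.val h))

namespace MvPolynomial

open RingTheory.Sequence

/-- Regularity of a form modulo a homogeneous ideal can be tested in the local ring at the origin,
as a homogeneous ideal is determined by its localization there. -/
theorem isSMulRegular_of_isSMulRegular_localization {σ k : Type*} [Field k]
    {Fs : List (MvPolynomial σ k)} (hFs : ∀ F ∈ Fs, ∃ i, F.IsHomogeneous i)
    {F : MvPolynomial σ k} {i : ℕ} (hF : F.IsHomogeneous i)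
    (R : Type*) [CommRing R] [Algebra (MvPolynomial σ k) R]
    [IsLocalization.AtPrime R (idealOfVars σ k)]
    (h : IsSMulRegular (R ⧸ (Ideal.ofList (Fs.map (algebraMap _ R)) • ⊤ : Submodule R R))
      (algebraMap (MvPolynomial σ k) R F)) :
    IsSMulRegular (MvPolynomial σ k ⧸ (Ideal.ofList Fs • ⊤ : Ideal (MvPolynomial σ k))) F := by
  rw [isSMulRegular_quotient_iff_mem_of_smul_mem] at h ⊢
  simp only [smul_eq_mul, Ideal.mul_top, ← Ideal.map_ofList] at h ⊢
  have hI := isHomogeneous_ofList hFs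
  intro z hz
  rw [← sum_homogeneousComponent z]
  refine Ideal.sum_mem _ fun e _ => ?_
  have hz' : F * homogeneousComponent e z ∈ Ideal.ofList Fs := by
    rw [← homogeneousComponent_mul_of_isHomogeneous hF]
    exact homogeneousComponent_mem_of_mem hI hz _
  have h1 := h (algebraMap _ R (homogeneousComponent e z)) (by
    rw [← map_mul]; exact Ideal.mem_map_of_mem _ hz')
  obtain ⟨t, ht, hmem⟩ := (IsLocalization.algebraMap_mem_map_algebraMap_iff
    (idealOfVars σ k).primeCompl _ _ _).1 h1
  exact mem_of_mul_mem_of_notMem_idealOfVars hI (homogeneousComponent_isHomogeneous e z) ht hmem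

/-- A homogeneous ideal `Q` of codimension at least `j` in `n` variables contains a regular sequence
of `j` forms of large degree. By unmixedness, the associated primes at the origin of a regular
sequence of less than `j` forms have dimension greater than that of `Q`, hence do not contain `Q`,
and homogeneous prime avoidance yields one more form. -/
theorem exists_isWeaklyRegular_isHomogeneous {k : Type u} [Field k] {n d : ℕ}
    {Q : Ideal (MvPolynomial (Fin n) k)} (hQ : Q.IsHomogeneous (homogeneousSubmodule (Fin n) k))
    (hQM : Q ≤ idealOfVars (Fin n) k)
    (hdim : ∀ q : Ideal (MvPolynomial (Fin n) k), q.IsPrime → Q ≤ q →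
      ringKrullDim (MvPolynomial (Fin n) k ⧸ q) ≤ d) (r j : ℕ) (hj : d + j ≤ n) :
    ∃ Fs : List (MvPolynomial (Fin n) k), Fs.length = j ∧
      (∀ F ∈ Fs, F ∈ Q ∧ ∃ i, r < i ∧ F.IsHomogeneous i) ∧
      IsWeaklyRegular (MvPolynomial (Fin n) k) Fs := by
  classical
  induction j with
  | zero => exact ⟨[], rfl, by simp, IsWeaklyRegular.nil _ _⟩
  | succ j ih =>
    obtain ⟨Fs, hlen, hFs, hreg⟩ := ih (by omega)
    let M := idealOfVars (Fin n) k
    have : M.IsPrime := isMaximal_idealOfVars.isPrime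
    let R := Localization.AtPrime M
    have hmem : ∀ F ∈ M, algebraMap _ R F ∈ maximalIdeal R := fun F hF =>
      (IsLocalization.AtPrime.to_map_mem_maximal_iff R M F).2 hF
    have hX : IsRegular R ((List.ofFn (X : Fin n → MvPolynomial (Fin n) k)).map
        (algebraMap _ R)) :=
      (isWeaklyRegular_X n).isRegular_of_isLocalization_of_mem R M fun x hx => by
        obtain ⟨i, rfl⟩ := List.mem_ofFn.1 hx
        exact X_mem_idealOfVars i
    have hregR : IsWeaklyRegular R (Fs.map (algebraMap _ R)) := hreg.of_flat
    have hdimR : ∀ q ∈ associatedPrimes R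
        (R ⧸ (Ideal.ofList (Fs.map (algebraMap _ R)) • ⊤ : Submodule R R)),
        (d : WithBot ℕ∞) < ringKrullDim (R ⧸ q) := by
      intro q hq
      have := le_ringKrullDim_quotient_add_length (M := R) n
        ⟨_, by simp, fun x hx => by
          obtain ⟨y, hy, rfl⟩ := List.mem_map.1 hx
          obtain ⟨i, rfl⟩ := List.mem_ofFn.1 hy
          exact hmem _ (X_mem_idealOfVars i), hX⟩ (Fs.map (algebraMap _ R))
        (fun x hx => by
          obtain ⟨y, hy, rfl⟩ := List.mem_map.1 hx
          exact hmem _ (hQM (hFs y hy).1)) hregR hq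
      rw [List.length_map, hlen] at this
      by_contra! hlt
      have h2 : (n : WithBot ℕ∞) ≤ (d : WithBot ℕ∞) + j := this.trans (by gcongr)
      have h3 : n ≤ d + j := by exact_mod_cast h2
      omega
    -- The associated primes at the origin need not be homogeneous; a form avoids a prime if and
    -- only if it avoids the homogeneous core, which is again prime.
    let core : Ideal R → Ideal (MvPolynomial (Fin n) k) := fun q =>
      ((q.comap (algebraMap _ R)).homogeneousCore (homogeneousSubmodule (Fin n) k)).toIdeal
    obtain ⟨i, F, hFi, hFQ, hF⟩ := exists_isHomogeneous_mem_forall_notMem hQ hQM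
      ((associatedPrimes.finite R (R ⧸ (Ideal.ofList (Fs.map (algebraMap _ R)) • ⊤ :
        Submodule R R))).toFinset.image core) (by
      intro p hp
      obtain ⟨q, hq, rfl⟩ := Finset.mem_image.1 hp
      rw [Set.Finite.mem_toFinset] at hq
      have hqp : q.IsPrime := hq.isPrime
      have hqc : (q.comap (algebraMap (MvPolynomial (Fin n) k) R)).IsPrime := inferInstance
      refine ⟨Ideal.IsPrime.homogeneousCore hqc, HomogeneousIdeal.isHomogeneous _, fun hle => ?_⟩
      exact (hdimR q hq).not_ge ((ringKrullDim_quotient_le_comap_algebraMap M.primeCompl q).trans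
        (hdim _ hqc (hle.trans (Ideal.toIdeal_homogeneousCore_le _ _)))))
    have hFreg : IsSMulRegular (MvPolynomial (Fin n) k ⧸
        (Ideal.ofList Fs • ⊤ : Ideal (MvPolynomial (Fin n) k))) F := by
      refine isSMulRegular_of_isSMulRegular_localization
        (fun F hF => (hFs F hF).2.imp fun _ h => h.2) hFi R ?_
      by_contra hcon
      have : algebraMap _ R F ∈ ⋃ p ∈ associatedPrimes R (R ⧸ (Ideal.ofList
          (Fs.map (algebraMap (MvPolynomial (Fin n) k) R)) • ⊤ : Submodule R R)), (p : Set R) := by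
        rw [biUnion_associatedPrimes_eq_compl_regular]; exact hcon
      simp only [Set.mem_iUnion] at this
      obtain ⟨q, hq, hFq⟩ := this
      exact hF (core q) (Finset.mem_image.2 ⟨q, (Set.Finite.mem_toFinset _).2 hq, rfl⟩)
        (Ideal.mem_homogeneousCore_of_homogeneous_of_mem ⟨i, hFi⟩ hFq)
    -- A power of a nonzerodivisor is a nonzerodivisor, and `F ^ (r + 1)` has degree greater than
    -- `r`. If `F` has degree zero, it vanishes, and zero is homogeneous of every degree.
    refine ⟨Fs ++ [F ^ (r + 1)], by simp [hlen], fun G hG => ?_,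
      (isWeaklyRegular_append_iff _ _ _).2 ⟨hreg, ?_⟩⟩
    · rcases List.mem_append.1 hG with hG | hG
      · exact hFs G hG
      rw [List.mem_singleton.1 hG]
      refine ⟨Q.pow_mem_of_mem hFQ _ (by omega), ?_⟩
      rcases Nat.eq_zero_or_pos i with rfl | hi
      · rw [hFi.eq_zero_of_mem_idealOfVars (hQM hFQ), zero_pow (by omega)]
        exact ⟨r + 1, by omega, isHomogeneous_zero _ _ _⟩
      · exact ⟨i * (r + 1), lt_of_lt_of_le (Nat.lt_succ_self r) (Nat.le_mul_of_pos_left _ hi),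
          hFi.pow _⟩
    · rw [isWeaklyRegular_singleton_iff]
      exact hFreg.pow _

end MvPolynomial

/-! ### Initial ideals -/

/-- The local ring `S`, with maximal ideal `𝔫`, is a local model of affine space at the origin:
the polynomial ring maps to `S`, inducing isomorphisms `P ⧸ Mⁱ ≃ S ⧸ 𝔫ⁱ` for all `i`, where `M` is
the ideal generated by the variables. -/
class IsOriginApproximation (n : ℕ) (k S : Type*) [Field k] [CommRing S] [IsLocalRing S]
    [Algebra (MvPolynomial (Fin n) k) S] : Prop where
  map_eq : (MvPolynomial.idealOfVars (Fin n) k).map (algebraMap _ S) = maximalIdeal S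
  comap_pow_le : ∀ i, (maximalIdeal S ^ i).comap (algebraMap (MvPolynomial (Fin n) k) S) ≤
    MvPolynomial.idealOfVars (Fin n) k ^ i
  exists_sub_mem : ∀ i (s : S), ∃ F : MvPolynomial (Fin n) k,
    s - algebraMap _ S F ∈ maximalIdeal S ^ i

section

open MvPolynomial RingTheory.Sequence

variable {n : ℕ} {k : Type*} [Field k]

namespace MvPolynomial

theorem IsHomogeneous.mem_pow_idealOfVars {σ : Type*} {F : MvPolynomial σ k} {i : ℕ}
    (hF : F.IsHomogeneous i) : F ∈ idealOfVars σ k ^ i := by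
  rw [mem_pow_idealOfVars_iff']
  intro x hx
  exact hF.coeff_eq_zero (by omega)

theorem homogeneousComponent_eq_zero_of_mem_pow_idealOfVars {σ : Type*} {F : MvPolynomial σ k}
    {i j : ℕ} (hF : F ∈ idealOfVars σ k ^ i) (hj : j < i) : homogeneousComponent j F = 0 := by
  rw [mem_pow_idealOfVars_iff'] at hF
  ext d
  rw [coeff_homogeneousComponent, coeff_zero]
  split_ifs with h
  · exact hF d (by omega)
  · rfl

theorem sub_homogeneousComponent_mem_pow_idealOfVars {σ : Type*} {F : MvPolynomial σ k}
    {i : ℕ} (hF : F ∈ idealOfVars σ k ^ i) :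
    F - homogeneousComponent i F ∈ idealOfVars σ k ^ (i + 1) := by
  rw [mem_pow_idealOfVars_iff'] at hF ⊢
  intro d hd
  rw [coeff_sub, coeff_homogeneousComponent]
  split_ifs with h
  · exact sub_self _
  · rw [hF d (by omega), sub_zero]

theorem homogeneousComponent_mul_of_isHomogeneous_of_lt {σ : Type*} {F z : MvPolynomial σ k}
    {i j : ℕ} (hF : F.IsHomogeneous i) (hj : j < i) : homogeneousComponent j (F * z) = 0 :=
  homogeneousComponent_eq_zero_of_mem_pow_idealOfVars
    (Ideal.mul_mem_right _ _ hF.mem_pow_idealOfVars) hj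

end MvPolynomial

variable {S : Type*} [CommRing S] [IsLocalRing S] [Algebra (MvPolynomial (Fin n) k) S]

namespace IsOriginApproximation

variable [IsOriginApproximation n k S]

theorem algebraMap_mem_pow {F : MvPolynomial (Fin n) k} {i : ℕ}
    (hF : F ∈ idealOfVars (Fin n) k ^ i) :
    algebraMap (MvPolynomial (Fin n) k) S F ∈ maximalIdeal S ^ i := by
  rw [← map_eq (n := n) (k := k), ← Ideal.map_pow]
  exact Ideal.mem_map_of_mem _ hF

theorem exists_isHomogeneous_sub_mem (n : ℕ) (k : Type*) [Field k]
    [Algebra (MvPolynomial (Fin n) k) S] [IsOriginApproximation n k S] {i : ℕ} {s : S}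
    (hs : s ∈ maximalIdeal S ^ i) :
    ∃ F : MvPolynomial (Fin n) k, F.IsHomogeneous i ∧
      s - algebraMap _ S F ∈ maximalIdeal S ^ (i + 1) := by
  obtain ⟨F, hF⟩ := exists_sub_mem (n := n) (k := k) (i + 1) s
  have hFi : F ∈ idealOfVars (Fin n) k ^ i := comap_pow_le (S := S) i <| by
    have := Ideal.pow_le_pow_right (Nat.le_succ i) hF
    rw [Ideal.mem_comap]
    exact (Submodule.sub_mem_iff_right _ hs).1 this
  refine ⟨_, homogeneousComponent_isHomogeneous i F, ?_⟩
  have h := Ideal.add_mem _ hF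
    (algebraMap_mem_pow (S := S) (sub_homogeneousComponent_mem_pow_idealOfVars hFi))
  rwa [map_sub, sub_add_sub_cancel] at h

end IsOriginApproximation

variable (n k) in
/-- The ideal of initial forms of `J`: its homogeneous elements of degree `i` are the forms which
agree with an element of `J` up to terms of order greater than `i`. -/
def initialIdeal [IsOriginApproximation n k S] (J : Ideal S) : Ideal (MvPolynomial (Fin n) k) where
  carrier := {F | ∀ i, algebraMap _ S (homogeneousComponent i F) ∈ maximalIdeal S ^ (i + 1) ⊔ J}
  zero_mem' := fun i => by simp
  add_mem' := fun {F G} hF hG i => by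
    rw [map_add, map_add]; exact Ideal.add_mem _ (hF i) (hG i)
  smul_mem' := fun G F hF i => by
    rw [smul_eq_mul, ← sum_homogeneousComponent G, Finset.sum_mul, map_sum, map_sum]
    refine Ideal.sum_mem _ fun a _ => ?_
    have hG := homogeneousComponent_isHomogeneous a G
    rcases lt_or_ge i a with h | h
    · rw [homogeneousComponent_mul_of_isHomogeneous_of_lt hG h, map_zero]
      exact Ideal.zero_mem _
    · obtain ⟨b, rfl⟩ := Nat.exists_eq_add_of_le h
      rw [homogeneousComponent_mul_of_isHomogeneous hG, map_mul]
      have h1 := Ideal.mul_mem_mul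
        (IsOriginApproximation.algebraMap_mem_pow (S := S) hG.mem_pow_idealOfVars) (hF b)
      rw [Ideal.mul_sup, ← pow_add, ← add_assoc] at h1
      have hle : maximalIdeal S ^ (a + b + 1) ⊔ maximalIdeal S ^ a * J ≤
          maximalIdeal S ^ (a + b + 1) ⊔ J := sup_le_sup_left Ideal.mul_le_right _
      exact hle h1

variable [IsOriginApproximation n k S]

theorem mem_initialIdeal {J : Ideal S} {F : MvPolynomial (Fin n) k} :
    F ∈ initialIdeal n k J ↔
      ∀ i, algebraMap _ S (homogeneousComponent i F) ∈ maximalIdeal S ^ (i + 1) ⊔ J := Iff.rfl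

theorem MvPolynomial.IsHomogeneous.mem_initialIdeal_iff {J : Ideal S}
    {F : MvPolynomial (Fin n) k} {i : ℕ} (hF : F.IsHomogeneous i) :
    F ∈ initialIdeal n k J ↔ algebraMap _ S F ∈ maximalIdeal S ^ (i + 1) ⊔ J := by
  rw [mem_initialIdeal]
  refine ⟨fun h => by simpa only [homogeneousComponent_eq_self hF] using h i, fun h j => ?_⟩
  rw [homogeneousComponent_of_mem hF]
  split_ifs with hij
  · rwa [hij]
  · rw [map_zero]; exact Ideal.zero_mem _

theorem initialIdeal_mono {J J' : Ideal S} (h : J ≤ J') :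
    initialIdeal n k J ≤ initialIdeal n k J' :=
  fun _ hF i => sup_le_sup_left h _ (hF i)

theorem isHomogeneous_initialIdeal (J : Ideal S) :
    (initialIdeal n k J).IsHomogeneous (homogeneousSubmodule (Fin n) k) :=
  isHomogeneous_ideal_of_homogeneousComponent_mem fun F hF i =>
    (homogeneousComponent_isHomogeneous i F).mem_initialIdeal_iff.2 (hF i)

theorem initialIdeal_bot : initialIdeal n k (⊥ : Ideal S) = ⊥ := by
  refine eq_bot_iff.2 fun F hF => ?_
  rw [Ideal.mem_bot, ← sum_homogeneousComponent F]
  refine Finset.sum_eq_zero fun i _ => ?_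
  have h := hF i
  rw [sup_bot_eq] at h
  rw [← homogeneousComponent_eq_self (homogeneousComponent_isHomogeneous i F)]
  exact homogeneousComponent_eq_zero_of_mem_pow_idealOfVars
    (IsOriginApproximation.comap_pow_le (S := S) _ (Ideal.mem_comap.2 h)) (Nat.lt_succ_self i)

theorem initialIdeal_le_idealOfVars {J : Ideal S} (hJ : J ≠ ⊤) :
    initialIdeal n k J ≤ idealOfVars (Fin n) k := by
  intro F hF
  have h := hF 0
  have hJ' : maximalIdeal S ^ (0 + 1) ⊔ J ≤ maximalIdeal S ^ 1 := by
    rw [zero_add, pow_one]; exact sup_le le_rfl (le_maximalIdeal hJ)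
  have h1 := homogeneousComponent_eq_zero_of_mem_pow_idealOfVars
    (IsOriginApproximation.comap_pow_le (S := S) 1 (hJ' h)) (Nat.lt_succ_self 0)
  rw [homogeneousComponent_eq_self (homogeneousComponent_isHomogeneous 0 F),
    homogeneousComponent_zero, C_eq_zero] at h1
  rw [← pow_one (idealOfVars (Fin n) k), mem_pow_idealOfVars_iff']
  intro x hx
  have : x = 0 := by
    rw [← Finsupp.degree_eq_zero_iff]; omega
  rw [this, h1]

variable {J : Ideal S} {F : MvPolynomial (Fin n) k} {f : S} {s : ℕ}

/-- If the form `F` is a nonzerodivisor modulo the initial ideal of `J`, multiplication by an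
element with initial form `F` raises orders modulo `J` exactly by the degree of `F`. -/
theorem mem_pow_sup_of_mul_mem (hF : F.IsHomogeneous s)
    (hreg : ∀ z, F * z ∈ initialIdeal n k J → z ∈ initialIdeal n k J)
    (hf : f - algebraMap _ S F ∈ maximalIdeal S ^ (s + 1)) {i : ℕ} {a : S}
    (ha : f * a ∈ maximalIdeal S ^ (i + s) ⊔ J) : a ∈ maximalIdeal S ^ i ⊔ J := by
  induction i with
  | zero => rw [pow_zero, Ideal.one_eq_top, top_sup_eq]; trivial
  | succ i ih =>
    have hle : maximalIdeal S ^ (i + 1 + s) ⊔ J ≤ maximalIdeal S ^ (i + s) ⊔ J :=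
      sup_le_sup_right (Ideal.pow_le_pow_right (by omega)) _
    obtain ⟨b, hb, j, hj, rfl⟩ := Submodule.mem_sup.1 (ih (hle ha))
    obtain ⟨G, hG, hbG⟩ := IsOriginApproximation.exists_isHomogeneous_sub_mem n k hb
    have h1 : f * b ∈ maximalIdeal S ^ (i + 1 + s) ⊔ J := by
      rw [mul_add] at ha
      exact (Ideal.add_mem_iff_left _ (Ideal.mem_sup_right (J.mul_mem_left f hj))).1 ha
    have hFG : F * G ∈ initialIdeal n k J := by
      rw [(hF.mul hG).mem_initialIdeal_iff, map_mul]
      have e : algebraMap _ S F * algebraMap _ S G = f * b - (f - algebraMap _ S F) * b -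
        algebraMap _ S F * (b - algebraMap _ S G) := by ring
      rw [e, show s + i + 1 = i + 1 + s by omega]
      refine Ideal.sub_mem _ (Ideal.sub_mem _ h1 (Ideal.mem_sup_left ?_)) (Ideal.mem_sup_left ?_)
      · rw [show i + 1 + s = s + 1 + i by omega, pow_add]
        exact Ideal.mul_mem_mul hf hb
      · rw [show i + 1 + s = s + (i + 1) by omega, pow_add]
        exact Ideal.mul_mem_mul
          (IsOriginApproximation.algebraMap_mem_pow hF.mem_pow_idealOfVars) hbG
    have h2 := hG.mem_initialIdeal_iff.1 (hreg G hFG)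
    have h3 := Ideal.add_mem _ (Ideal.mem_sup_left (T := J) hbG) h2
    rw [sub_add_cancel] at h3
    exact Ideal.add_mem _ h3 (Ideal.mem_sup_right hj)

/-- If the initial form of `f` is a nonzerodivisor modulo the initial ideal of `J`, then `f` is a
nonzerodivisor modulo `J`: an element annihilated by `f` has arbitrarily large order modulo `J`. -/
theorem mem_of_mul_mem_of_initialIdeal [IsNoetherianRing S] (hF : F.IsHomogeneous s)
    (hreg : ∀ z, F * z ∈ initialIdeal n k J → z ∈ initialIdeal n k J)
    (hf : f - algebraMap _ S F ∈ maximalIdeal S ^ (s + 1)) {a : S} (ha : f * a ∈ J) : a ∈ J := by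
  refine Ideal.mem_of_forall_mem_sup_maximalIdeal_pow J fun i => ?_
  rw [sup_comm]
  exact mem_pow_sup_of_mul_mem hF hreg hf (Ideal.mem_sup_right ha)

/-- In an element `g + a f` of `J + (f)`, the coefficient `a` can be taken, modulo `J`, of the order
that the degrees predict, so that no cancellation produces initial forms outside of those of `J`
and the multiples of `F`. -/
theorem initialIdeal_sup_span_singleton (hF : F.IsHomogeneous s)
    (hreg : ∀ z, F * z ∈ initialIdeal n k J → z ∈ initialIdeal n k J)
    (hf : f - algebraMap _ S F ∈ maximalIdeal S ^ (s + 1)) :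
    initialIdeal n k (J ⊔ Ideal.span {f}) = initialIdeal n k J ⊔ Ideal.span {F} := by
  refine le_antisymm (fun G hG => ?_) (sup_le (initialIdeal_mono le_sup_left) ?_)
  · rw [← sum_homogeneousComponent G]
    refine Ideal.sum_mem _ fun i _ => ?_
    have hGi := homogeneousComponent_isHomogeneous i G
    have hG := hG i
    generalize homogeneousComponent i G = G at hGi hG
    rw [← sup_assoc] at hG
    obtain ⟨g, hg, y, hy, hgy⟩ := Submodule.mem_sup.1 hG
    obtain ⟨a, rfl⟩ := Ideal.mem_span_singleton'.1 hy
    have hfs : f ∈ maximalIdeal S ^ s := by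
      have := Ideal.add_mem _ (Ideal.pow_le_pow_right (Nat.le_succ s) hf)
        (IsOriginApproximation.algebraMap_mem_pow (S := S) hF.mem_pow_idealOfVars)
      rwa [sub_add_cancel] at this
    -- Below the degree of `F`, the multiple of `f` is of higher order and does not contribute.
    rcases lt_or_ge i s with h | h
    · refine Ideal.mem_sup_left (hGi.mem_initialIdeal_iff.2 ?_)
      rw [← hgy]
      exact Ideal.add_mem _ hg (Ideal.mem_sup_left
        (Ideal.mul_mem_left _ _ (Ideal.pow_le_pow_right h hfs)))
    · obtain ⟨t, rfl⟩ := Nat.exists_eq_add_of_le' h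
      have h1 : f * a ∈ maximalIdeal S ^ (t + s) ⊔ J := by
        have hle : maximalIdeal S ^ (t + s + 1) ⊔ J ≤ maximalIdeal S ^ (t + s) ⊔ J :=
          sup_le_sup_right (Ideal.pow_le_pow_right (Nat.le_succ _)) _
        have h2 := hle hg
        rw [mul_comm, ← Ideal.add_mem_iff_right _ h2, hgy]
        exact Ideal.mem_sup_left
          (IsOriginApproximation.algebraMap_mem_pow hGi.mem_pow_idealOfVars)
      obtain ⟨b, hb, j, hj, rfl⟩ := Submodule.mem_sup.1 (mem_pow_sup_of_mul_mem hF hreg hf h1)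
      obtain ⟨H, hH, hbH⟩ := IsOriginApproximation.exists_isHomogeneous_sub_mem n k hb
      have h3 : G - H * F ∈ initialIdeal n k J := by
        rw [(hGi.sub (hH.mul hF)).mem_initialIdeal_iff, map_sub, map_mul, ← hgy]
        have e : g + (b + j) * f - algebraMap _ S H * algebraMap _ S F =
          g + j * f + (b - algebraMap _ S H) * f +
            algebraMap _ S H * (f - algebraMap _ S F) := by ring
        rw [e]
        refine Ideal.add_mem _ (Ideal.add_mem _ (Ideal.add_mem _ hg
          (Ideal.mem_sup_right (J.mul_mem_right _ hj))) (Ideal.mem_sup_left ?_))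
          (Ideal.mem_sup_left ?_)
        · rw [show t + s + 1 = t + 1 + s by omega, pow_add]
          exact Ideal.mul_mem_mul hbH hfs
        · rw [add_assoc, pow_add]
          exact Ideal.mul_mem_mul
            (IsOriginApproximation.algebraMap_mem_pow hH.mem_pow_idealOfVars) hf
      rw [← sub_add_cancel G (H * F)]
      exact Ideal.add_mem _ (Ideal.mem_sup_left h3)
        (Ideal.mem_sup_right (Ideal.mul_mem_left _ _ (Ideal.mem_span_singleton_self F)))
  · rw [Ideal.span_singleton_le_iff_mem, hF.mem_initialIdeal_iff]
    rw [← sub_sub_cancel f (algebraMap _ S F)]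
    exact Ideal.sub_mem _ (Ideal.mem_sup_right (Ideal.mem_sup_right
      (Ideal.mem_span_singleton_self f))) (Ideal.mem_sup_left hf)

/-- Elements of `S` whose initial forms are a regular sequence are a regular sequence, and these
forms generate the initial ideal. -/
theorem isWeaklyRegular_and_initialIdeal_ofList [IsNoetherianRing S]
    (Fs : List (MvPolynomial (Fin n) k)) (g : MvPolynomial (Fin n) k → S)
    (hFs : ∀ F ∈ Fs, ∃ s, F.IsHomogeneous s ∧ g F - algebraMap _ S F ∈ maximalIdeal S ^ (s + 1))
    (hreg : IsWeaklyRegular (MvPolynomial (Fin n) k) Fs) :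
    IsWeaklyRegular S (Fs.map g) ∧
      initialIdeal n k (Ideal.ofList (Fs.map g)) = Ideal.ofList Fs := by
  induction Fs using List.reverseRecOn with
  | nil =>
    rw [List.map_nil, Ideal.ofList_nil, Ideal.ofList_nil]
    exact ⟨IsWeaklyRegular.nil _ _, initialIdeal_bot⟩
  | append_singleton Fs F ih =>
    obtain ⟨hreg1, hreg2⟩ := (isWeaklyRegular_append_iff _ _ _).1 hreg
    obtain ⟨ih1, ih2⟩ := ih (fun G hG => hFs G (List.mem_append_left _ hG)) hreg1
    obtain ⟨s, hF, hf⟩ := hFs F (by simp)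
    rw [isWeaklyRegular_singleton_iff, isSMulRegular_quotient_iff_mem_of_smul_mem] at hreg2
    simp only [smul_eq_mul, Ideal.mul_top, ← ih2] at hreg2
    constructor
    · rw [List.map_append, isWeaklyRegular_append_iff]
      refine ⟨ih1, ?_⟩
      rw [List.map_singleton, isWeaklyRegular_singleton_iff,
        isSMulRegular_quotient_iff_mem_of_smul_mem]
      simp only [smul_eq_mul, Ideal.mul_top]
      exact fun a ha => mem_of_mul_mem_of_initialIdeal hF hreg2 hf ha
    · rw [List.map_append, Ideal.ofList_append, Ideal.ofList_append, List.map_singleton,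
        Ideal.ofList_singleton, Ideal.ofList_singleton,
        initialIdeal_sup_span_singleton hF hreg2 hf, ih2]

end

/-! ### The associated graded ring of a quotient -/

section

open MvPolynomial

variable {n : ℕ} {k S B : Type*} [Field k] [CommRing S] [Algebra (MvPolynomial (Fin n) k) S]
  [CommRing B]

/-- The homogenization `x_i ↦ π(x_i) t` of the map `P → S → B`, as a map to `B[t]`. -/
noncomputable def homogenizedMap (n : ℕ) (k : Type*) [Field k]
    [Algebra (MvPolynomial (Fin n) k) S] (π : S →+* B) :
    MvPolynomial (Fin n) k →+* Polynomial B :=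
  eval₂Hom (Polynomial.C.comp (π.comp ((algebraMap (MvPolynomial (Fin n) k) S).comp C)))
    fun i => Polynomial.C (π (algebraMap (MvPolynomial (Fin n) k) S (X i))) * Polynomial.X

theorem homogenizedMap_monomial (π : S →+* B) (m : Fin n →₀ ℕ) (a : k) :
    homogenizedMap n k π (monomial m a) =
      Polynomial.C (π (algebraMap _ S (monomial m a))) * Polynomial.X ^ m.degree := by
  rw [homogenizedMap, coe_eval₂Hom, eval₂_monomial, monomial_eq, Finsupp.prod, Finsupp.prod,
    Finsupp.degree_apply, ← Finset.prod_pow_eq_pow_sum]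
  simp only [RingHom.comp_apply, map_mul, map_prod, map_pow, mul_pow, Finset.prod_mul_distrib,
    mul_assoc]

theorem coeff_homogenizedMap (π : S →+* B) (F : MvPolynomial (Fin n) k) (i : ℕ) :
    (homogenizedMap n k π F).coeff i = π (algebraMap _ S (homogeneousComponent i F)) := by
  induction F using MvPolynomial.induction_on' with
  | monomial m a =>
    rw [homogenizedMap_monomial, Polynomial.coeff_C_mul_X_pow,
      homogeneousComponent_of_mem (isHomogeneous_monomial a rfl)]
    split_ifs <;> simp
  | add F G hF hG => rw [map_add, map_add, map_add, map_add, Polynomial.coeff_add, hF, hG]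

variable [IsLocalRing S] [IsLocalRing B] {π : S →+* B}

theorem map_mem_maximalIdeal_pow_iff (hπ : Function.Surjective π) {s : S} {i : ℕ} :
    π s ∈ maximalIdeal B ^ i ↔ s ∈ maximalIdeal S ^ i ⊔ RingHom.ker π := by
  rw [← map_maximalIdeal_of_surjective π hπ, ← Ideal.map_pow, ← Ideal.mem_comap,
    Ideal.comap_map_of_surjective' _ hπ]

theorem map_maximalIdeal_pow_of_surjective (hπ : Function.Surjective π) (i : ℕ) :
    (maximalIdeal S ^ i).map π = maximalIdeal B ^ i := by
  rw [← map_maximalIdeal_of_surjective π hπ, Ideal.map_pow]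

variable [IsOriginApproximation n k S]

theorem homogenizedMap_mem_reesAlgebra (hπ : Function.Surjective π) (F : MvPolynomial (Fin n) k) :
    homogenizedMap n k π F ∈ reesAlgebra (maximalIdeal B) := by
  rw [mem_reesAlgebra_iff]
  intro i
  rw [coeff_homogenizedMap, map_mem_maximalIdeal_pow_iff hπ]
  exact Ideal.mem_sup_left (IsOriginApproximation.algebraMap_mem_pow
    (homogeneousComponent_isHomogeneous i F).mem_pow_idealOfVars)

/-- The map from the polynomial ring to the associated graded ring of a quotient `B` of `S`. -/
noncomputable def toAssociatedGradedRing (n : ℕ) (k : Type*) [Field k]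
    [Algebra (MvPolynomial (Fin n) k) S] [IsOriginApproximation n k S] {π : S →+* B}
    (hπ : Function.Surjective π) :
    MvPolynomial (Fin n) k →+* AssociatedGradedRing (maximalIdeal B) :=
  (Ideal.Quotient.mk _).comp ((homogenizedMap n k π).codRestrict (reesAlgebra (maximalIdeal B))
    (homogenizedMap_mem_reesAlgebra hπ))

/-- The associated graded ring of `B = S / J` is the polynomial ring modulo the initial ideal
of `J`. -/
theorem ker_toAssociatedGradedRing (hπ : Function.Surjective π) :
    RingHom.ker (toAssociatedGradedRing n k hπ) = initialIdeal n k (RingHom.ker π) := by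
  ext F
  rw [RingHom.mem_ker, toAssociatedGradedRing, RingHom.comp_apply, Ideal.Quotient.eq_zero_iff_mem,
    mem_initialIdeal]
  refine forall_congr' fun i => ?_
  rw [← map_mem_maximalIdeal_pow_iff hπ, ← coeff_homogenizedMap]
  rfl

theorem toAssociatedGradedRing_surjective (hπ : Function.Surjective π) :
    Function.Surjective (toAssociatedGradedRing n k hπ) := by
  intro y
  obtain ⟨g, rfl⟩ := Ideal.Quotient.mk_surjective y
  have hg := (mem_reesAlgebra_iff _ _).1 g.2
  have h : ∀ i, ∃ F : MvPolynomial (Fin n) k, F.IsHomogeneous i ∧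
      π (algebraMap _ S F) - (g : Polynomial B).coeff i ∈ maximalIdeal B ^ (i + 1) := fun i => by
    have := hg i
    rw [← map_maximalIdeal_pow_of_surjective hπ,
      Ideal.mem_map_iff_of_surjective _ hπ] at this
    obtain ⟨s, hs, hsg⟩ := this
    obtain ⟨F, hF, hFs⟩ := IsOriginApproximation.exists_isHomogeneous_sub_mem n k hs
    refine ⟨F, hF, ?_⟩
    rw [← hsg, ← map_sub, ← neg_sub, map_neg, neg_mem_iff,
      ← map_maximalIdeal_pow_of_surjective hπ]
    exact Ideal.mem_map_of_mem _ hFs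
  choose F hF hFg using h
  refine ⟨∑ i ∈ Finset.range ((g : Polynomial B).natDegree + 1), F i, ?_⟩
  rw [toAssociatedGradedRing, RingHom.comp_apply, Ideal.Quotient.eq]
  intro i
  change (homogenizedMap n k π _ - (g : Polynomial B)).coeff i ∈ _
  rw [Polynomial.coeff_sub, coeff_homogenizedMap, map_sum]
  simp only [homogeneousComponent_of_mem (hF _)]
  rw [Finset.sum_ite_eq]
  split_ifs with hi
  · exact hFg i
  · rw [Polynomial.coeff_eq_zero_of_natDegree_lt (by simpa using hi)]
    simp

end

/-- If the initial ideal of the kernel of `S → B` is generated by a regular sequence, the associated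
graded ring of `B` is a complete intersection. -/
theorem isCompleteIntersectionRing_associatedGradedRing {n : ℕ} {k S B : Type u} [Field k]
    [CommRing S] [IsLocalRing S] [Algebra (MvPolynomial (Fin n) k) S]
    [IsOriginApproximation n k S] [CommRing B] [IsLocalRing B] {π : S →+* B}
    (hπ : Function.Surjective π) (Fs : List (MvPolynomial (Fin n) k))
    (hFs : RingTheory.Sequence.IsWeaklyRegular (MvPolynomial (Fin n) k) Fs)
    (hker : initialIdeal n k (RingHom.ker π) = Ideal.ofList Fs) :
    IsCompleteIntersectionRing (AssociatedGradedRing (maximalIdeal B)) :=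
  isCompleteIntersectionRing_of_surjective (toAssociatedGradedRing n k hπ)
    (toAssociatedGradedRing_surjective hπ) Fs hFs ((ker_toAssociatedGradedRing hπ).trans hker)

/-! ### Regularity of local models of affine space -/

section

open MvPolynomial RingTheory.Sequence

variable (n : ℕ) (k : Type*) [Field k]

namespace IsOriginApproximation

variable (S : Type*) [CommRing S] [IsLocalRing S]

theorem ofList_map_X (k : Type*) [Field k] [Algebra (MvPolynomial (Fin n) k) S]
    [IsOriginApproximation n k S] :
    Ideal.ofList ((List.ofFn (X : Fin n → MvPolynomial (Fin n) k)).map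
      (algebraMap _ S)) = maximalIdeal S := by
  rw [← Ideal.map_ofList, ← map_eq (n := n) (k := k)]
  congr 1
  refine congrArg Ideal.span (Set.ext fun F => ?_)
  exact List.mem_ofFn

/-- The initial forms of the images of the variables are the variables themselves. -/
theorem isRegular_map_X (k : Type*) [Field k] [IsNoetherianRing S]
    [Algebra (MvPolynomial (Fin n) k) S] [IsOriginApproximation n k S] :
    IsRegular S ((List.ofFn (X : Fin n → MvPolynomial (Fin n) k)).map (algebraMap _ S)) := by
  refine ⟨(isWeaklyRegular_and_initialIdeal_ofList (S := S) _ (algebraMap _ S) (fun F hF => ?_)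
    (isWeaklyRegular_X n)).1, ?_⟩
  · obtain ⟨i, rfl⟩ := List.mem_ofFn.1 hF
    exact ⟨1, isHomogeneous_X _ _, by simp⟩
  · rw [ofList_map_X, smul_eq_mul, Ideal.mul_top]
    exact Ne.symm Ideal.IsPrime.ne_top'

theorem spanFinrank_maximalIdeal_le (k : Type*) [Field k] [Algebra (MvPolynomial (Fin n) k) S]
    [IsOriginApproximation n k S] :
    (maximalIdeal S).spanFinrank ≤ n := by
  rw [← map_eq (n := n) (k := k), idealOfVars, Ideal.map_span, ← Set.range_comp]
  refine (Submodule.spanFinrank_span_le_ncard_of_finite (Set.finite_range _)).trans ?_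
  rw [← Set.image_univ]
  refine (Set.ncard_image_le Set.finite_univ).trans ?_
  rw [Set.ncard_univ, Nat.card_fin]

/-- The variables are a regular sequence of length `n`. -/
theorem le_ringKrullDim (k : Type*) [Field k] [IsNoetherianRing S]
    [Algebra (MvPolynomial (Fin n) k) S] [IsOriginApproximation n k S] :
    (n : WithBot ℕ∞) ≤ ringKrullDim S := by
  have h := ringKrullDim_add_length_eq_ringKrullDim_of_isRegular _ (isRegular_map_X n S k)
  rw [← h, List.length_map, List.length_ofFn, ofList_map_X]
  have : 0 ≤ ringKrullDim (S ⧸ maximalIdeal S) := ringKrullDim_nonneg_of_nontrivial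
  exact le_add_of_nonneg_left this

theorem isRegularLocalRing (k : Type*) [Field k] [IsNoetherianRing S]
    [Algebra (MvPolynomial (Fin n) k) S] [IsOriginApproximation n k S] :
    IsRegularLocalRing S :=
  .of_spanFinrank_maximalIdeal_le _
    ((Nat.cast_le.2 (spanFinrank_maximalIdeal_le n S k)).trans (le_ringKrullDim n S k))

theorem ringKrullDim_eq (k : Type*) [Field k] [IsNoetherianRing S]
    [Algebra (MvPolynomial (Fin n) k) S] [IsOriginApproximation n k S] :
    ringKrullDim S = n :=
  le_antisymm ((ringKrullDim_le_spanFinrank_maximalIdeal S).trans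
    (Nat.cast_le.2 (spanFinrank_maximalIdeal_le n S k))) (le_ringKrullDim n S k)

end IsOriginApproximation

namespace AdicCompletion

instance isMaximal_map_idealOfVars : ((idealOfVars (Fin n) k).map (algebraMap _
    (AdicCompletion (idealOfVars (Fin n) k) (MvPolynomial (Fin n) k)))).IsMaximal :=
  AdicCompletion.isMaximal_map_of_le _ _ le_rfl (idealOfVars_fg _ _)

instance isLocalRing_idealOfVars :
    IsLocalRing (AdicCompletion (idealOfVars (Fin n) k) (MvPolynomial (Fin n) k)) :=
  have := AdicCompletion.isAdicComplete_self _ (idealOfVars_fg (Fin n) k)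
  isLocalRing_of_isAdicComplete_maximal ((idealOfVars (Fin n) k).map (algebraMap _
    (AdicCompletion (idealOfVars (Fin n) k) (MvPolynomial (Fin n) k))))

theorem maximalIdeal_eq_map_idealOfVars :
    maximalIdeal (AdicCompletion (idealOfVars (Fin n) k) (MvPolynomial (Fin n) k)) =
      (idealOfVars (Fin n) k).map (algebraMap _ _) :=
  (eq_maximalIdeal (isMaximal_map_idealOfVars n k)).symm

theorem isAdicComplete_maximalIdeal_idealOfVars : IsAdicComplete
    (maximalIdeal (AdicCompletion (idealOfVars (Fin n) k) (MvPolynomial (Fin n) k)))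
    (AdicCompletion (idealOfVars (Fin n) k) (MvPolynomial (Fin n) k)) := by
  rw [maximalIdeal_eq_map_idealOfVars]
  exact AdicCompletion.isAdicComplete_self _ (idealOfVars_fg (Fin n) k)

theorem maximalIdeal_pow_eq_ker (i : ℕ) :
    maximalIdeal (AdicCompletion (idealOfVars (Fin n) k) (MvPolynomial (Fin n) k)) ^ i =
      RingHom.ker (AdicCompletion.evalₐ (idealOfVars (Fin n) k) i) := by
  rw [maximalIdeal_eq_map_idealOfVars, AdicCompletion.ker_evalₐ (idealOfVars_fg (Fin n) k)]

instance isOriginApproximation : IsOriginApproximation n k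
    (AdicCompletion (idealOfVars (Fin n) k) (MvPolynomial (Fin n) k)) where
  map_eq := (maximalIdeal_eq_map_idealOfVars n k).symm
  comap_pow_le i F hF := by
    rw [maximalIdeal_pow_eq_ker, Ideal.mem_comap, RingHom.mem_ker,
      AdicCompletion.evalₐ_algebraMap] at hF
    exact Ideal.Quotient.eq_zero_iff_mem.1 hF
  exists_sub_mem i s := by
    obtain ⟨F, hF⟩ := Ideal.Quotient.mk_surjective (AdicCompletion.evalₐ _ i s)
    refine ⟨F, ?_⟩
    rw [maximalIdeal_pow_eq_ker, RingHom.mem_ker, map_sub, AdicCompletion.evalₐ_algebraMap, hF,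
      sub_self]

end AdicCompletion

end

/-! ### Algebraically independent variables -/

theorem ringKrullDim_le_of_isIntegral {R S : Type*} [CommRing R] [CommRing S] (f : R →+* S)
    (hf : f.IsIntegral) : ringKrullDim S ≤ ringKrullDim R := by
  algebraize [f]
  have : Algebra.IsIntegral R S := ⟨hf⟩
  refine Order.krullDim_le_of_strictMono (PrimeSpectrum.comap (algebraMap R S)) fun x y hxy => ?_
  exact Ideal.IsIntegral.comap_lt_comap (R := R) (I := x.asIdeal) (J := y.asIdeal) hxy

/-- If `V(q)` has dimension greater than `d` then some `d + 1` of the variables are algebraically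
independent modulo `q`, for the variables contain a transcendence basis. -/
theorem MvPolynomial.exists_algebraicIndependent_X {k : Type u} [Field k] {n d : ℕ}
    {q : Ideal (MvPolynomial (Fin n) k)} [q.IsPrime]
    (h : (d : WithBot ℕ∞) < ringKrullDim (MvPolynomial (Fin n) k ⧸ q)) :
    ∃ τ : Fin (d + 1) → Fin n, AlgebraicIndependent k fun i => Ideal.Quotient.mk q (X (τ i)) := by
  obtain ⟨s, g, hg, hint⟩ := exists_integral_inj_algHom_of_fg k (MvPolynomial (Fin n) k ⧸ q)
  have hs : d + 1 ≤ s := by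
    have h1 := h.trans_le (ringKrullDim_le_of_isIntegral g.toRingHom hint)
    rw [MvPolynomial.ringKrullDim_of_isNoetherianRing, ringKrullDim_eq_zero_of_field, zero_add,
      Nat.card_fin] at h1
    exact_mod_cast h1
  have hind : AlgebraicIndependent k fun i => g (X i) :=
    (algebraicIndependent_X (Fin s) k).map' hg
  set x : Fin n → MvPolynomial (Fin n) k ⧸ q := fun i => Ideal.Quotient.mk q (X i) with hx
  have htop : Algebra.adjoin k (Set.range x) = ⊤ := by
    have : Set.range x = (Ideal.Quotient.mkₐ k q) '' Set.range X := by
      rw [← Set.range_comp]; rfl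
    rw [this, ← AlgHom.map_adjoin, adjoin_range_X, Algebra.map_top, AlgHom.range_eq_top]
    exact Ideal.Quotient.mkₐ_surjective k q
  have hsurj : Function.Surjective (algebraMap (Algebra.adjoin k (Set.range x))
      (MvPolynomial (Fin n) k ⧸ q)) := fun y => ⟨⟨y, htop ▸ Algebra.mem_top⟩, rfl⟩
  have halg : Algebra.IsAlgebraic (Algebra.adjoin k (Set.range x)) (MvPolynomial (Fin n) k ⧸ q) :=
    ⟨fun y => by obtain ⟨z, rfl⟩ := hsurj y; exact isAlgebraic_algebraMap z⟩
  obtain ⟨T, hT, hTb⟩ := exists_isTranscendenceBasis_subset (R := k) (Set.range x)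
  have hle := hind.lift_cardinalMk_le_trdeg
  rw [← hTb.cardinalMk_eq_trdeg] at hle
  have hle' :
      Cardinal.lift.{u} (Cardinal.mk (Fin (d + 1))) ≤ Cardinal.lift.{0} (Cardinal.mk T) := by
    refine le_trans ?_ hle
    simpa using hs
  obtain ⟨e⟩ := Cardinal.lift_mk_le'.1 hle'
  choose τ hτ using fun i => hT (e i).2
  refine ⟨τ, ?_⟩
  have := hTb.1.comp e e.injective
  convert this using 2 with i
  exact hτ i

/-! ### Growth of the Hilbert–Samuel function -/

/-- Iterating `M = N + I M` as in Nakayama's lemma. -/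
theorem Submodule.sup_pow_smul_top_eq_top {R M : Type*} [CommRing R] [AddCommGroup M] [Module R M]
    {I : Ideal R} {N : Submodule R M} (h : N ⊔ I • ⊤ = ⊤) (m : ℕ) : N ⊔ I ^ m • ⊤ = ⊤ := by
  induction m with
  | zero => simp
  | succ m ih =>
    refine top_le_iff.1 ?_
    calc (⊤ : Submodule R M) = N ⊔ I • (N ⊔ I ^ m • ⊤) := by rw [ih, h]
      _ ≤ N ⊔ I ^ (m + 1) • ⊤ := by
        rw [Submodule.smul_sup, ← mul_smul, ← pow_succ']
        exact sup_le le_sup_left (sup_le (Submodule.smul_le_right.trans le_sup_left) le_sup_right)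

section

open MvPolynomial

variable {k A : Type*} [Field k] [CommRing A] [Algebra k A]

/-- If finitely many `e i` span `A` over `k` modulo the ideal `(b)`, then they and the monomials in
`b` with exponents less than `m` span `A` over `k` modulo `(b)ᵐ`. -/
theorem span_mul_sup_span_pow_eq_top {d : ℕ} (b : Fin d → A) {ι : Type*} (e : ι → A)
    (he : Submodule.span k (Set.range e) ⊔ (Ideal.span (Set.range b)).restrictScalars k = ⊤)
    (m : ℕ) :
    Submodule.span k (Set.range fun p : (Fin d → Fin m) × ι => (∏ j, b j ^ (p.1 j : ℕ)) * e p.2) ⊔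
      (Ideal.span (Set.range b) ^ m).restrictScalars k = ⊤ := by
  algebraize [(aeval b : MvPolynomial (Fin d) k →ₐ[k] A).toRingHom]
  have : IsScalarTower k (MvPolynomial (Fin d) k) A := .of_algebraMap_eq fun x => by
    rw [RingHom.algebraMap_toAlgebra]; simp
  have hmap : (idealOfVars (Fin d) k).map (algebraMap _ A) = Ideal.span (Set.range b) := by
    rw [idealOfVars, Ideal.map_span, ← Set.range_comp]
    congr 2
    ext i
    exact aeval_X b i
  have hsmul : ∀ i, (idealOfVars (Fin d) k ^ i • ⊤ : Submodule (MvPolynomial (Fin d) k) A) =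
      (Ideal.span (Set.range b) ^ i).restrictScalars _ := fun i => by
    rw [Ideal.smul_top_eq_map, Ideal.map_pow, hmap]
  set E := Submodule.span k
    (Set.range fun p : (Fin d → Fin m) × ι => (∏ j, b j ^ (p.1 j : ℕ)) * e p.2) with hE
  have h1 : Submodule.span (MvPolynomial (Fin d) k) (Set.range e) ⊔ idealOfVars (Fin d) k • ⊤ =
      ⊤ := by
    refine top_le_iff.1 fun x _ => ?_
    obtain ⟨y, hy, z, hz, rfl⟩ := Submodule.mem_sup.1 (he ▸ Submodule.mem_top : x ∈ _)
    have h2 := hsmul 1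
    rw [pow_one, pow_one] at h2
    rw [h2]
    exact Submodule.add_mem_sup (Submodule.span_le_restrictScalars k _ _ hy) hz
  refine top_le_iff.1 fun x _ => ?_
  obtain ⟨y, hy, z, hz, rfl⟩ := Submodule.mem_sup.1
    (Submodule.sup_pow_smul_top_eq_top h1 m ▸ Submodule.mem_top : x ∈ _)
  rw [hsmul] at hz
  refine Submodule.add_mem _ ?_ (Submodule.mem_sup_right hz)
  have key : ∀ (p : MvPolynomial (Fin d) k) (i : ι),
      aeval b p * e i ∈ E ⊔ (Ideal.span (Set.range b) ^ m).restrictScalars k := by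
    intro p i
    induction p using MvPolynomial.induction_on' with
    | add p q hp hq => rw [map_add, add_mul]; exact Submodule.add_mem _ hp hq
    | monomial α a =>
      by_cases hα : ∀ j, α j < m
      · refine Submodule.mem_sup_left ?_
        rw [aeval_monomial, mul_assoc, ← Algebra.smul_def]
        refine Submodule.smul_mem _ _ (Submodule.subset_span ⟨⟨fun j => ⟨α j, hα j⟩, i⟩, ?_⟩)
        rw [Finsupp.prod_fintype _ _ fun j => pow_zero _]
      · push Not at hα
        obtain ⟨j, hj⟩ := hα
        refine Submodule.mem_sup_right ?_
        rw [Submodule.restrictScalars_mem, ← hmap, ← Ideal.map_pow]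
        refine Ideal.mul_mem_right _ _ (Ideal.mem_map_of_mem (algebraMap _ A) ?_)
        refine Ideal.pow_le_pow_right ?_ (isHomogeneous_monomial a rfl).mem_pow_idealOfVars
        exact hj.trans (Finsupp.le_degree j α)
  obtain ⟨c, rfl⟩ := Finsupp.mem_span_range_iff_exists_finsupp.1 hy
  exact Submodule.sum_mem _ fun i _ => key (c i) i

variable [IsLocalRing A] [IsNoetherianRing A]

/-- An ideal primary to the maximal ideal has a finite-dimensional quotient. -/
theorem exists_span_sup_eq_top (hres : ∀ x : A, ∃ c : k, x - algebraMap k A c ∈ maximalIdeal A)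
    {𝔟 : Ideal A} (h𝔟 : 𝔟.radical = maximalIdeal A) :
    ∃ (C : ℕ) (e : Fin C → A),
      Submodule.span k (Set.range e) ⊔ 𝔟.restrictScalars k = ⊤ := by
  obtain ⟨g, b, hb⟩ := Submodule.fg_iff_exists_fin_generating_family.1
    (maximalIdeal A).fg_of_isNoetherianRing
  obtain ⟨m, hm⟩ := Ideal.exists_pow_le_of_le_radical_of_fg h𝔟.ge
    (maximalIdeal A).fg_of_isNoetherianRing
  have h := span_mul_sup_span_pow_eq_top (k := k) b (fun _ : Unit => (1 : A)) (by
    refine top_le_iff.1 fun x _ => ?_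
    obtain ⟨c, hc⟩ := hres x
    rw [← sub_add_cancel x (algebraMap k A c), add_comm]
    refine Submodule.add_mem_sup ?_ (hb.ge hc)
    rw [Algebra.algebraMap_eq_smul_one]
    exact Submodule.smul_mem _ _ (Submodule.subset_span ⟨(), rfl⟩)) m
  refine ⟨_, (fun p => (∏ j, b j ^ (p.1 j : ℕ)) * 1) ∘
    (Fintype.equivFin ((Fin g → Fin m) × Unit)).symm, ?_⟩
  rw [(Equiv.surjective _).range_comp]
  refine top_le_iff.1 (h.ge.trans (sup_le_sup_left ?_ _))
  intro x hx
  refine hm (?_ : x ∈ _)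
  rwa [← show Ideal.span (Set.range b) = maximalIdeal A from hb]

/-- The growth of the Hilbert–Samuel function is at most that of a polynomial of degree the
dimension: `A ⧸ 𝔞ᵐ` has at most `C mᵈ` linearly independent elements. -/
theorem exists_forall_card_le_mul_pow
    (hres : ∀ x : A, ∃ c : k, x - algebraMap k A c ∈ maximalIdeal A)
    {𝔞 : Ideal A} (h𝔞 : 𝔞.radical = maximalIdeal A) {d : ℕ} (hd : ringKrullDim A = d) :
    ∃ C : ℕ, ∀ (m : ℕ) (ι : Type) [Fintype ι] (v : ι → A),
      (∀ c : ι → k, ∑ i, c i • v i ∈ 𝔞 ^ m → c = 0) → Fintype.card ι ≤ C * m ^ d := by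
  obtain ⟨s, hs, hcard⟩ := Ideal.exists_finset_card_eq_height_of_isNoetherianRing (maximalIdeal A)
  have hcard' : s.card = d := by
    have := maximalIdeal_height_eq_ringKrullDim (R := A)
    rw [hd, ← hcard] at this
    exact_mod_cast this
  let b : Fin d → A := fun i => s.equivFin.symm (Fin.cast hcard'.symm i)
  have hb : Ideal.span (Set.range b) = Ideal.span s := by
    congr 1
    ext x
    refine ⟨?_, fun hx => ⟨Fin.cast hcard' (s.equivFin ⟨x, hx⟩), by simp [b]⟩⟩
    rintro ⟨i, rfl⟩
    exact (s.equivFin.symm _).2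
  have hrad : (Ideal.span (Set.range b)).radical = maximalIdeal A := by
    rw [hb]
    refine le_antisymm (Ideal.IsPrime.radical_le_iff inferInstance |>.2 hs.1.2) ?_
    rw [Ideal.radical_eq_sInf]
    refine le_sInf fun p hp => ?_
    exact hs.2 ⟨hp.2, hp.1⟩ (le_maximalIdeal hp.2.ne_top)
  obtain ⟨C, e, he⟩ := exists_span_sup_eq_top hres hrad
  obtain ⟨e₀, he₀⟩ := Ideal.exists_pow_le_of_le_radical_of_fg h𝔞.ge
    (maximalIdeal A).fg_of_isNoetherianRing
  -- With `𝔪 ^ e₀ ≤ 𝔞`, the ideal `𝔞 ^ m` contains `(b) ^ (e₀ m)`, modulo which `A` is spanned by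
  -- `(e₀ m) ^ d * C` elements.
  refine ⟨e₀ ^ d * C, fun m ι _ v hv => ?_⟩
  have htop := span_mul_sup_span_pow_eq_top b e he (e₀ * m)
  set w := fun p : (Fin d → Fin (e₀ * m)) × Fin C => (∏ j, b j ^ (p.1 j : ℕ)) * e p.2
  have hle : Ideal.span (Set.range b) ^ (e₀ * m) ≤ 𝔞 ^ m := by
    rw [pow_mul]
    refine Ideal.pow_right_mono ((Ideal.pow_right_mono ?_ _).trans he₀) m
    exact Ideal.le_radical.trans hrad.le
  let π := ((𝔞 ^ m).restrictScalars k).mkQ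
  have hspan : Submodule.span k (Set.range (π ∘ w)) = ⊤ := by
    rw [Set.range_comp, ← Submodule.map_span]
    have h1 : Submodule.span k (Set.range w) ⊔ (𝔞 ^ m).restrictScalars k = ⊤ :=
      top_le_iff.1 (htop.ge.trans (sup_le_sup_left (fun x hx => hle hx) _))
    have h2 := congrArg (Submodule.map π) h1
    rwa [Submodule.map_sup, Submodule.mkQ_map_self, sup_bot_eq, Submodule.map_top,
      Submodule.range_mkQ] at h2
  have hli : LinearIndependent k (π ∘ v) := by
    rw [Fintype.linearIndependent_iff]
    intro c hc i
    refine congrFun (hv c ?_) i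
    have h3 : π (∑ i, c i • v i) = 0 := by
      rw [map_sum, ← hc]
      simp
    exact (Submodule.Quotient.mk_eq_zero _).1 h3
  have : Module.Finite k (A ⧸ (𝔞 ^ m).restrictScalars k) := .of_fg_top
    (hspan ▸ Submodule.fg_span (Set.finite_range _))
  calc Fintype.card ι ≤ Module.finrank k (A ⧸ (𝔞 ^ m).restrictScalars k) :=
        hli.fintype_card_le_finrank
    _ = (Set.range (π ∘ w)).finrank k := by rw [Set.finrank, hspan, finrank_top]
    _ ≤ Fintype.card ((Fin d → Fin (e₀ * m)) × Fin C) := finrank_range_le_card _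
    _ = e₀ ^ d * C * m ^ d := by
      rw [Fintype.card_prod, Fintype.card_fun, Fintype.card_fin, Fintype.card_fin,
        Fintype.card_fin, mul_pow]
      ring

end

/-! ### The dimension of the initial ideal -/

section

open MvPolynomial

/-- **Artin–Rees** for the image of `S` in a finite algebra: the topology of `A` restricts to that
of `S / ker (S → A)`, up to a shift by a constant. -/
theorem Ideal.exists_forall_mem_pow_sup_ker (S : Type*) {A : Type*} [CommRing S]
    [IsNoetherianRing S] [CommRing A] [Algebra S A] [Module.Finite S A] (I : Ideal S) :
    ∃ e : ℕ, ∀ (m : ℕ) (s : S), algebraMap S A s ∈ I.map (algebraMap S A) ^ (m + e) →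
      s ∈ I ^ m ⊔ RingHom.ker (algebraMap S A) := by
  obtain ⟨e, he⟩ := Ideal.exists_pow_inf_eq_pow_smul I (LinearMap.range (Algebra.linearMap S A))
  refine ⟨e, fun m s hs => ?_⟩
  have h1 : algebraMap S A s ∈ (I ^ (m + e) • ⊤ ⊓ LinearMap.range (Algebra.linearMap S A) :
      Submodule S A) := by
    refine ⟨?_, s, rfl⟩
    rw [Ideal.smul_top_eq_map, Ideal.map_pow]
    exact hs
  rw [he _ (Nat.le_add_left e m), Nat.add_sub_cancel] at h1
  have h2 : algebraMap S A s ∈ I ^ m • LinearMap.range (Algebra.linearMap S A) :=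
    (smul_mono_right (I ^ m) inf_le_right :
      I ^ m • (I ^ e • ⊤ ⊓ LinearMap.range (Algebra.linearMap S A)) ≤ _) h1
  rw [← Submodule.map_top, ← Submodule.map_smul'', smul_eq_mul, Ideal.mul_top] at h2
  obtain ⟨y, hy, hys⟩ := h2
  rw [← add_sub_cancel y s]
  refine Submodule.add_mem_sup hy ?_
  rw [RingHom.mem_ker, map_sub, sub_eq_zero]
  exact hys.symm

theorem MvPolynomial.rename_mem_pow_idealOfVars {σ τ k : Type*} [Field k] (f : σ → τ)
    {G : MvPolynomial σ k} {i : ℕ} (hG : G ∈ idealOfVars σ k ^ i) :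
    rename f G ∈ idealOfVars τ k ^ i := by
  have h : (idealOfVars σ k).map (rename f : MvPolynomial σ k →ₐ[k] MvPolynomial τ k) ≤
      idealOfVars τ k := by
    rw [idealOfVars, Ideal.map_span, Ideal.span_le]
    rintro _ ⟨_, ⟨i, rfl⟩, rfl⟩
    rw [rename_X]
    exact X_mem_idealOfVars _
  have h1 := Ideal.mem_map_of_mem (rename f : MvPolynomial σ k →ₐ[k] MvPolynomial τ k) hG
  rw [Ideal.map_pow] at h1
  exact Ideal.pow_right_mono h i h1

/-- The initial ideal of the kernel of a finite map `S → A` has dimension at most `dim A`.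
Otherwise `d + 1` of the variables, where `d = dim A`, are algebraically independent modulo
the initial ideal. The `(t + 1)ᵈ⁺¹` monomials with exponents at most `t` in these variables are then
linearly independent in `A` up to an order linear in `t`, by the Artin–Rees lemma, which
contradicts the growth of order `tᵈ` of the Hilbert–Samuel function. -/
theorem ringKrullDim_quotient_le_of_initialIdeal_le {n d : ℕ} {k : Type u} {S A : Type*} [Field k]
    [CommRing S] [IsLocalRing S] [IsNoetherianRing S] [Algebra (MvPolynomial (Fin n) k) S]
    [IsOriginApproximation n k S] [CommRing A] [IsLocalRing A] [IsNoetherianRing A] [Algebra S A]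
    [Module.Finite S A] (hd : ringKrullDim A = d)
    (hrad : ((maximalIdeal S).map (algebraMap S A)).radical = maximalIdeal A)
    (hres : ∀ x : A, ∃ c : k,
      x - algebraMap S A (algebraMap (MvPolynomial (Fin n) k) S (C c)) ∈ maximalIdeal A)
    {q : Ideal (MvPolynomial (Fin n) k)} [q.IsPrime]
    (hq : initialIdeal n k (RingHom.ker (algebraMap S A)) ≤ q) :
    ringKrullDim (MvPolynomial (Fin n) k ⧸ q) ≤ d := by
  by_contra! hlt
  obtain ⟨τ, hτ⟩ := exists_algebraicIndependent_X hlt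
  algebraize [((algebraMap S A).comp (algebraMap (MvPolynomial (Fin n) k) S)).comp C]
  obtain ⟨e, he⟩ := Ideal.exists_forall_mem_pow_sup_ker S (A := A) (maximalIdeal S)
  obtain ⟨K, hK⟩ := exists_forall_card_le_mul_pow (k := k) hres hrad hd
  -- The monomials with exponents at most `t` have degree at most `(d + 1) t`, so they are to be
  -- independent modulo order `(d + 1) t + 1`; the constant `e` is the loss in the Artin–Rees lemma.
  have key : ∀ t : ℕ, (t + 1) ^ (d + 1) ≤ K * ((d + 1) * t + 1 + e) ^ d := by
    intro t
    let μ : (Fin (d + 1) → Fin (t + 1)) → (Fin (d + 1) →₀ ℕ) :=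
      fun β => Finsupp.equivFunOnFinite.symm fun j => β j
    have hμ : Function.Injective μ := fun β γ h => by
      funext j
      exact Fin.ext (DFunLike.congr_fun h j)
    have hμd : ∀ β, (μ β).degree < (d + 1) * t + 1 := fun β => by
      rw [Finsupp.degree_eq_sum, Nat.lt_succ_iff]
      refine (Finset.sum_le_card_nsmul _ _ t fun j _ => Nat.lt_succ_iff.1 (β j).2).trans ?_
      simp
    have h := hK ((d + 1) * t + 1 + e) (Fin (d + 1) → Fin (t + 1))
      (fun β => algebraMap S A (algebraMap _ S (rename τ (monomial (μ β) (1 : k))))) ?_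
    · simpa using h
    intro c hc
    let G : MvPolynomial (Fin (d + 1)) k := ∑ β, monomial (μ β) (c β)
    have hG : algebraMap S A (algebraMap _ S (rename τ G)) ∈
        (maximalIdeal S).map (algebraMap S A) ^ ((d + 1) * t + 1 + e) := by
      convert hc using 1
      simp only [G, map_sum]
      refine Finset.sum_congr rfl fun β _ => ?_
      rw [Algebra.smul_def, RingHom.algebraMap_toAlgebra, RingHom.comp_apply, RingHom.comp_apply,
        ← map_mul, ← map_mul]
      congr 2
      rw [rename_monomial, rename_monomial, C_mul_monomial, mul_one]
    have hG' := he _ _ hG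
    -- The homogeneous components of `G` vanish one after the other: each lies in the initial ideal,
    -- hence in `q`, modulo which the variables are algebraically independent.
    have hmem : ∀ i ≤ (d + 1) * t + 1, G ∈ idealOfVars (Fin (d + 1)) k ^ i := by
      intro i
      induction i with
      | zero => simp
      | succ i ih =>
        intro hi
        have hGi := sub_homogeneousComponent_mem_pow_idealOfVars (ih (by omega))
        have h1 := IsOriginApproximation.algebraMap_mem_pow (S := S)
          (rename_mem_pow_idealOfVars τ hGi)
        have h2 : rename τ (homogeneousComponent i G) ∈ q := by
          refine hq ((((homogeneousComponent_isHomogeneous i G).rename_isHomogeneous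
            (f := τ)).mem_initialIdeal_iff (S := S)).2 ?_)
          have hle : maximalIdeal S ^ ((d + 1) * t + 1) ⊔ RingHom.ker (algebraMap S A) ≤
              maximalIdeal S ^ (i + 1) ⊔ RingHom.ker (algebraMap S A) :=
            sup_le_sup_right (Ideal.pow_le_pow_right hi) _
          have h3 := Ideal.sub_mem _ (hle hG')
            (Ideal.mem_sup_left (T := RingHom.ker (algebraMap S A)) h1)
          rwa [map_sub, map_sub, sub_sub_cancel] at h3
        have h4 : homogeneousComponent i G = 0 := by
          refine (injective_iff_map_eq_zero _).1 hτ _ ?_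
          rw [← Ideal.Quotient.eq_zero_iff_mem] at h2
          rw [← h2]
          refine DFunLike.congr_fun (?_ : _ = (Ideal.Quotient.mkₐ k q).comp (rename τ)) _
          ext j
          simp
        rwa [h4, sub_zero] at hGi
    funext β
    have h5 := (mem_pow_idealOfVars_iff' _ _).1 (hmem _ le_rfl) (μ β) (hμd β)
    simp only [G, coeff_sum, coeff_monomial] at h5
    rwa [Finset.sum_eq_single β (fun γ _ hγ => if_neg (hμ.ne hγ))
      (fun h => absurd (Finset.mem_univ _) h), if_pos rfl] at h5
  -- For this `t`, the right-hand side is at most `t (t + 1) ^ d`.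
  have h6 := key (K * (d + 1 + e) ^ d)
  set t := K * (d + 1 + e) ^ d with ht
  have h7 : (d + 1) * t + 1 + e ≤ (d + 1 + e) * (t + 1) := by nlinarith
  have h8 : (t + 1) * (t + 1) ^ d ≤ t * (t + 1) ^ d :=
    calc (t + 1) * (t + 1) ^ d = (t + 1) ^ (d + 1) := (pow_succ' _ _).symm
      _ ≤ K * ((d + 1 + e) * (t + 1)) ^ d := h6.trans (by gcongr)
      _ = t * (t + 1) ^ d := by rw [mul_pow, ht]; ring
  have h9 := Nat.le_of_mul_le_mul_right h8 (by positivity)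
  omega

end

/-! ### Finiteness over a complete ring -/

/-- Convergence in a finite power of `R` is componentwise, as `Iⁿ (ι → R)` consists of the functions
with values in `Iⁿ`. -/
theorem IsPrecomplete.pi {R ι : Type*} [CommRing R] [Finite ι] (I : Ideal R) [IsPrecomplete I R] :
    IsPrecomplete I (ι → R) := by
  classical
  have := Fintype.ofFinite ι
  have hmem : ∀ (n : ℕ) (x : ι → R),
      x ∈ (I ^ n • ⊤ : Submodule R (ι → R)) ↔ ∀ i, x i ∈ (I ^ n • ⊤ : Submodule R R) := by
    intro n x
    refine ⟨fun h i => ?_, fun h => ?_⟩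
    · have := Submodule.mem_map_of_mem (f := LinearMap.proj (R := R) (φ := fun _ : ι => R) i) h
      rw [Submodule.map_smul''] at this
      exact (smul_mono_right (I ^ n) le_top : I ^ n • Submodule.map _ ⊤ ≤ _) this
    · rw [pi_eq_sum_univ' x]
      refine Submodule.sum_mem _ fun i _ => Submodule.smul_mem_smul ?_ trivial
      simpa using h i
  refine ⟨fun f hf => ?_⟩
  have h1 : ∀ i, ∃ L : R, ∀ n, f n i ≡ L [SMOD (I ^ n • ⊤ : Submodule R R)] := fun i =>
    IsPrecomplete.prec inferInstance fun {m n} hmn => by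
      have := hf hmn
      rw [SModEq.sub_mem] at this ⊢
      exact (hmem _ _).1 this i
  choose L hL using h1
  refine ⟨L, fun n => ?_⟩
  rw [SModEq.sub_mem, hmem]
  intro i
  have := hL i n
  rwa [SModEq.sub_mem] at this

/-- A separated module over a complete ring is finite if it is so modulo `I`: a map from a finite
free module which is surjective modulo `I` is surjective. -/
theorem Module.Finite.of_span_sup_smul_top {R N : Type*} [CommRing R] [AddCommGroup N] [Module R N]
    (I : Ideal R) [IsPrecomplete I R] [IsHausdorff I N] {C : ℕ} (e : Fin C → N)
    (he : Submodule.span R (Set.range e) ⊔ I • ⊤ = ⊤) : Module.Finite R N := by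
  have := IsPrecomplete.pi (ι := Fin C) I
  refine Module.Finite.of_surjective (Fintype.linearCombination R e)
    (surjective_of_mkQ_comp_surjective (I := I) fun y => ?_)
  obtain ⟨y, rfl⟩ := Submodule.mkQ_surjective _ y
  obtain ⟨x, hx, z, hz, rfl⟩ := Submodule.mem_sup.1 (he ▸ Submodule.mem_top : y ∈ _)
  rw [← Fintype.range_linearCombination] at hx
  obtain ⟨c, rfl⟩ := hx
  refine ⟨c, ?_⟩
  have hz' : Submodule.mkQ (I • ⊤) z = 0 := (Submodule.Quotient.mk_eq_zero _).2 hz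
  rw [LinearMap.comp_apply, map_add, hz', add_zero]

section

open MvPolynomial

/-- A complete Noetherian local ring `A` with coefficient field `k` is finite over the ring of power
series in the generators of an ideal primary to the maximal ideal. -/
theorem exists_finite_ringHom_adicCompletion {n : ℕ} {k A : Type*} [Field k] [CommRing A]
    [IsLocalRing A] [IsNoetherianRing A] [IsAdicComplete (maximalIdeal A) A] (σ : k →+* A)
    (hσ : ∀ x : A, ∃ c : k, x - σ c ∈ maximalIdeal A) (a : Fin n → A)
    (ha : (Ideal.span (Set.range a)).radical = maximalIdeal A) :
    ∃ ψ : AdicCompletion (idealOfVars (Fin n) k) (MvPolynomial (Fin n) k) →+* A, ψ.Finite ∧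
      ∀ F, ψ (algebraMap _ _ F) = eval₂Hom σ a F := by
  have hmap : (idealOfVars (Fin n) k).map (eval₂Hom σ a) = Ideal.span (Set.range a) := by
    rw [idealOfVars, Ideal.map_span, ← Set.range_comp]
    congr 2
    ext i
    simp
  have hle : Ideal.span (Set.range a) ≤ maximalIdeal A := Ideal.le_radical.trans ha.le
  obtain ⟨ψ, hψ⟩ : ∃ ψ : AdicCompletion (idealOfVars (Fin n) k) (MvPolynomial (Fin n) k) →+* A,
      ∀ F, ψ (algebraMap _ _ F) = eval₂Hom σ a F :=
    ⟨((AdicCompletion.ofAlgEquiv (maximalIdeal A)).symm :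
      AdicCompletion (maximalIdeal A) A →+* A).comp (AdicCompletion.mapRingHom
        (idealOfVars (Fin n) k) (maximalIdeal A) (eval₂Hom σ a)
        (Ideal.map_le_iff_le_comap.1 (hmap.trans_le hle))), fun F => by
      rw [RingHom.comp_apply, AdicCompletion.mapRingHom_algebraMap]
      exact AdicCompletion.ofAlgEquiv_symm_of _ _⟩
  refine ⟨ψ, ?_, hψ⟩
  have hcompl := AdicCompletion.isAdicComplete_maximalIdeal_idealOfVars n k
  set S := AdicCompletion (idealOfVars (Fin n) k) (MvPolynomial (Fin n) k)
  have hmap' : (maximalIdeal S).map ψ = Ideal.span (Set.range a) := by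
    rw [← IsOriginApproximation.map_eq (n := n) (k := k), Ideal.map_map, ← hmap]
    congr 1
    exact RingHom.ext hψ
  algebraize [σ, ψ]
  obtain ⟨C, e, he⟩ := exists_span_sup_eq_top hσ ha
  have : IsHausdorff ((maximalIdeal S).map (algebraMap S A)) A := by
    rw [RingHom.algebraMap_toAlgebra, hmap']
    exact IsHausdorff.of_isLocalRing _ _ (ne_top_of_le_ne_top Ideal.IsPrime.ne_top' hle)
  have := IsHausdorff.map_algebraMap_iff.1 this
  have hfin : Module.Finite S A := by
    refine .of_span_sup_smul_top (maximalIdeal S) e (top_le_iff.1 fun x _ => ?_)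
    obtain ⟨y, hy, z, hz, rfl⟩ := Submodule.mem_sup.1 (he ▸ Submodule.mem_top : x ∈ _)
    refine Submodule.add_mem_sup ?_ ?_
    · refine Submodule.span_induction (fun y hy => Submodule.subset_span hy)
        (Submodule.zero_mem _) (fun _ _ _ _ => Submodule.add_mem _) (fun c y _ hy => ?_) hy
      have : c • y = (algebraMap _ S (MvPolynomial.C c : MvPolynomial (Fin n) k)) • y := by
        rw [Algebra.smul_def, Algebra.smul_def, RingHom.algebraMap_toAlgebra σ,
          RingHom.algebraMap_toAlgebra ψ, hψ, coe_eval₂Hom, eval₂_C]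
      rw [this]
      exact Submodule.smul_mem _ _ hy
    · rw [Ideal.smul_top_eq_map, RingHom.algebraMap_toAlgebra, hmap']
      exact hz
  exact hfin

end

/-! ### Construction of the approximation -/

section

open MvPolynomial RingTheory.Sequence

/-- Lifting forms of large degree in the initial ideal of `ker (S → A)` to elements of
`ker (S → A)`. -/
theorem exists_isWeaklyRegular_mem_ker {n d : ℕ} {k : Type u} {S A : Type*} [Field k]
    [CommRing S] [IsLocalRing S] [IsNoetherianRing S] [Algebra (MvPolynomial (Fin n) k) S]
    [IsOriginApproximation n k S] [CommRing A] [IsLocalRing A] [IsNoetherianRing A] (ψ : S →+* A)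
    (hψ : ψ.Finite) (hd : ringKrullDim A = d)
    (hrad : ((maximalIdeal S).map ψ).radical = maximalIdeal A)
    (hres : ∀ x : A, ∃ c : k, x - ψ (algebraMap (MvPolynomial (Fin n) k) S (C c)) ∈ maximalIdeal A)
    (r j : ℕ) (hj : d + j ≤ n) :
    ∃ (fs : List S) (Fs : List (MvPolynomial (Fin n) k)), fs.length = j ∧
      (∀ f ∈ fs, f ∈ RingHom.ker ψ ∧ f ∈ maximalIdeal S ^ (r + 1)) ∧
      IsWeaklyRegular S fs ∧ IsWeaklyRegular (MvPolynomial (Fin n) k) Fs ∧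
      initialIdeal n k (Ideal.ofList fs) = Ideal.ofList Fs := by
  algebraize [ψ]
  obtain ⟨Fs, hlen, hFs, hreg⟩ := exists_isWeaklyRegular_isHomogeneous
    (isHomogeneous_initialIdeal (n := n) (k := k) (RingHom.ker ψ))
    (initialIdeal_le_idealOfVars (RingHom.ker_ne_top ψ))
    (fun q hq hle => ringKrullDim_quotient_le_of_initialIdeal_le hd hrad hres hle) r j hj
  have h : ∀ F : MvPolynomial (Fin n) k, ∃ f : S, F ∈ Fs → f ∈ RingHom.ker ψ ∧ ∃ i, r < i ∧
      F.IsHomogeneous i ∧ f - algebraMap _ S F ∈ maximalIdeal S ^ (i + 1) := by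
    intro F
    by_cases hF : F ∈ Fs
    · obtain ⟨hF1, i, hi, hFi⟩ := hFs F hF
      obtain ⟨y, hy, f, hf, hyf⟩ := Submodule.mem_sup.1 (hFi.mem_initialIdeal_iff.1 hF1)
      refine ⟨f, fun _ => ⟨hf, i, hi, hFi, ?_⟩⟩
      rwa [← hyf, sub_add_cancel_right, neg_mem_iff]
    · exact ⟨0, fun h => absurd h hF⟩
  choose g hg using h
  obtain ⟨h1, h2⟩ := isWeaklyRegular_and_initialIdeal_ofList Fs g
    (fun F hF => (hg F hF).2.imp fun _ h => h.2) hreg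
  refine ⟨Fs.map g, Fs, by rw [List.length_map, hlen], fun f hf => ?_, h1, hreg, h2⟩
  obtain ⟨F, hF, rfl⟩ := List.mem_map.1 hf
  obtain ⟨hker, i, hi, hFi, hsub⟩ := hg F hF
  refine ⟨hker, ?_⟩
  have h3 := Ideal.add_mem _ (Ideal.pow_le_pow_right (by omega : r + 1 ≤ i + 1) hsub)
    (Ideal.pow_le_pow_right hi (IsOriginApproximation.algebraMap_mem_pow (S := S)
      hFi.mem_pow_idealOfVars))
  rwa [sub_add_cancel] at h3

end

/-- Krull's height theorem for an ideal primary to the maximal ideal. -/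
theorem ringKrullDim_le_spanFinrank_of_radical_eq {A : Type*} [CommRing A] [IsLocalRing A]
    [IsNoetherianRing A] {𝔞 : Ideal A} (h : 𝔞.radical = maximalIdeal A) :
    ringKrullDim A ≤ 𝔞.spanFinrank := by
  have hle : 𝔞 ≤ maximalIdeal A := Ideal.le_radical.trans h.le
  have hmin : 𝔞.minimalPrimes = {maximalIdeal A} := by
    rw [← Ideal.radical_minimalPrimes, h, Ideal.minimalPrimes_eq_subsingleton_self]
  have h1 := 𝔞.height_le_spanFinrank (ne_top_of_le_ne_top Ideal.IsPrime.ne_top' hle)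
  rw [Ideal.height_eq_inf_minimalPrimes, hmin, iInf_singleton] at h1
  rw [← maximalIdeal_height_eq_ringKrullDim]
  exact_mod_cast h1

theorem Ideal.exists_fin_spanFinrank_span_eq {A : Type*} [CommRing A] {𝔞 : Ideal A} (h : 𝔞.FG)
    {n : ℕ} (hn : 𝔞.spanFinrank = n) : ∃ a : Fin n → A, Ideal.span (Set.range a) = 𝔞 := by
  have := (Submodule.FG.finite_generators h).to_subtype
  have e := (Finite.equivFinOfCardEq ((Submodule.FG.generators_ncard h).trans hn)).symm
  refine ⟨fun i => e i, ?_⟩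
  rw [show (fun i => (e i : A)) = Subtype.val ∘ e from rfl, e.surjective.range_comp,
    Subtype.range_coe]
  exact 𝔞.span_generators

/-- The approximation: `B` is the quotient of the power series ring `S` in `μ(𝔞)` variables by a
regular sequence of maximal length in the kernel of `S → A`, of order greater than `r + 1`, whose
initial forms are a regular sequence. -/
theorem exists_isCIApproximation {k A : Type u} [Field k] [CommRing A] [IsLocalRing A]
    [IsNoetherianRing A] [IsAdicComplete (maximalIdeal A) A] (σ : k →+* A)
    (hσ : ∀ x : A, ∃ c : k, x - σ c ∈ maximalIdeal A) {𝔞 : Ideal A}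
    (h𝔞 : 𝔞.radical = maximalIdeal A) {n : ℕ} (hn : 𝔞.spanFinrank = n) (r : ℕ) :
    ∃ (B : Type u) (_ : CommRing B) (_ : IsLocalRing B) (φ : B →+* A) (_ : IsLocalHom φ)
      (π : AdicCompletion (MvPolynomial.idealOfVars (Fin n) k) (MvPolynomial (Fin n) k) →+* B),
      IsCIApproximation φ (maximalIdeal B) 𝔞 ∧ Function.Bijective (ResidueField.map φ) ∧
      (maximalIdeal B).spanFinrank = n ∧ Function.Surjective π ∧
      RingHom.ker π ≤ maximalIdeal _ ^ (r + 2) ∧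
      (ringKrullDim A < n → RingHom.ker π ≠ ⊥) := by
  obtain ⟨a, ha⟩ := 𝔞.exists_fin_spanFinrank_span_eq (IsNoetherian.noetherian 𝔞) hn
  obtain ⟨ψ, hψfin, hψ⟩ := exists_finite_ringHom_adicCompletion σ hσ a (by rw [ha, h𝔞])
  set S := AdicCompletion (MvPolynomial.idealOfVars (Fin n) k) (MvPolynomial (Fin n) k)
  have hle : 𝔞 ≤ maximalIdeal A := Ideal.le_radical.trans h𝔞.le
  have hmap : (maximalIdeal S).map ψ = 𝔞 := by
    rw [← IsOriginApproximation.map_eq (n := n) (k := k), Ideal.map_map,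
      show ψ.comp (algebraMap _ S) = _ from RingHom.ext hψ, MvPolynomial.idealOfVars,
      Ideal.map_span, ← Set.range_comp, ← ha]
    congr 2
    ext i
    simp
  have hψC : ∀ c, ψ (algebraMap _ S (MvPolynomial.C c)) = σ c := fun c => by
    rw [hψ, MvPolynomial.coe_eval₂Hom, MvPolynomial.eval₂_C]
  obtain ⟨d, hd⟩ : ∃ d : ℕ, ringKrullDim A = d := by
    have h1 := ringKrullDim_ne_bot (R := A)
    have h2 := ringKrullDim_ne_top (R := A)
    generalize ringKrullDim A = x at h1 h2
    induction x with
    | bot => exact absurd rfl h1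
    | coe x =>
      induction x with
      | top => exact absurd rfl h2
      | coe x => exact ⟨x, rfl⟩
  have hdn : d ≤ n := by
    have := ringKrullDim_le_spanFinrank_of_radical_eq h𝔞
    rw [hd, hn] at this
    exact_mod_cast this
  obtain ⟨fs, Fs, hlen, hfs, hreg, hregF, hinit⟩ := exists_isWeaklyRegular_mem_ker ψ hψfin hd
    (by rw [hmap, h𝔞]) (fun x => (hσ x).imp fun c hc => by rwa [hψC]) (r + 1) (n - d) (by omega)
  set I := Ideal.ofList fs with hI
  have hIker : I ≤ RingHom.ker ψ := Ideal.span_le.2 fun f hf => (hfs f hf).1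
  have hIpow : I ≤ maximalIdeal S ^ (r + 2) := Ideal.span_le.2 fun f hf => (hfs f hf).2
  have hfsmax : ∀ f ∈ fs, f ∈ maximalIdeal S := fun f hf =>
    Ideal.pow_le_self (by omega) (hfs f hf).2
  have hItop : I ≠ ⊤ := ne_top_of_le_ne_top (RingHom.ker_ne_top ψ) hIker
  have : Nontrivial (S ⧸ I) := Ideal.Quotient.nontrivial_iff.2 hItop
  have hlocal : IsLocalRing (S ⧸ I) := .of_surjective' _ Ideal.Quotient.mk_surjective
  set π := Ideal.Quotient.mk I with hπ
  have hπs : Function.Surjective π := Ideal.Quotient.mk_surjective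
  have hπm : (maximalIdeal S).map π = maximalIdeal (S ⧸ I) := map_maximalIdeal_of_surjective π hπs
  let φ : S ⧸ I →+* A := Ideal.Quotient.lift I ψ hIker
  have hφπ : φ.comp π = ψ := Ideal.Quotient.lift_comp_mk I ψ hIker
  have hφmap : (maximalIdeal (S ⧸ I)).map φ = 𝔞 := by rw [← hπm, Ideal.map_map, hφπ, hmap]
  have hφfin : φ.Finite := .of_comp_finite (f := π) (by rwa [hφπ])
  have hφlocal : IsLocalHom φ := ⟨fun b hb => by
    by_contra hnu
    exact (hle (hφmap ▸ Ideal.mem_map_of_mem φ ((mem_maximalIdeal _).2 hnu))) hb⟩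
  have hregS : RingTheory.Sequence.IsRegular S fs :=
    (isRegular_iff_isWeaklyRegular_of_subset_maximalIdeal hfsmax).2 hreg
  have hdim : ringKrullDim (S ⧸ I) = d := by
    have h1 := ringKrullDim_add_length_eq_ringKrullDim_of_isRegular fs hregS
    rw [IsOriginApproximation.ringKrullDim_eq n S k, hlen, ← hI] at h1
    have h2 : (n : WithBot ℕ∞) = (d : WithBot ℕ∞) + ((n - d : ℕ) : WithBot ℕ∞) := by
      rw [← Nat.cast_add, Nat.add_sub_cancel' hdn]
    rw [h2] at h1
    exact ENat.WithBot.add_natCast_cancel.1 h1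
  have hregular := IsOriginApproximation.isRegularLocalRing n S k
  have hkerπ : RingHom.ker π = I := Ideal.mk_ker
  refine ⟨S ⧸ I, inferInstance, hlocal, φ, hφlocal, π, ⟨hφmap, hφfin, by rw [hd, hdim], ?_, ?_⟩,
    ⟨RingHom.injective _, fun y => ?_⟩, le_antisymm ?_ ?_, hπs, hkerπ.trans_le hIpow, ?_⟩
  · exact isCompleteIntersectionLocalRing_of_surjective π hπs fs hregS hkerπ
  · exact isCompleteIntersectionRing_associatedGradedRing hπs Fs hregF
      ((congrArg (initialIdeal n k) hkerπ).trans hinit)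
  · obtain ⟨x, rfl⟩ := residue_surjective y
    obtain ⟨c, hc⟩ := hσ x
    refine ⟨residue _ (π (algebraMap _ S (MvPolynomial.C c : MvPolynomial (Fin n) k))), ?_⟩
    rw [ResidueField.map_residue, ← RingHom.comp_apply φ π, hφπ, hψC, eq_comm]
    exact Ideal.Quotient.eq.2 hc
  · rw [← hπm]
    exact (Ideal.spanFinrank_map_le_of_fg π (maximalIdeal S).fg_of_isNoetherianRing).trans
      (IsOriginApproximation.spanFinrank_maximalIdeal_le n S k)
  · have h1 := Ideal.spanFinrank_map_le_of_fg φ (maximalIdeal (S ⧸ I)).fg_of_isNoetherianRing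
    rwa [hφmap, hn] at h1
  · intro hlt hbot
    rw [hkerπ] at hbot
    rw [hd, ← hdim, ← IsOriginApproximation.ringKrullDim_eq n S k, hbot] at hlt
    exact hlt.ne (ringKrullDim_eq_of_ringEquiv (RingEquiv.quotientBot S))

/-! ### Reductions -/

section

variable {R : Type*} [CommRing R] [IsLocalRing R]

theorem Ideal.le_of_le_sup_maximalIdeal_mul {I J : Ideal R} (hI : I.FG)
    (h : I ≤ J ⊔ maximalIdeal R * I) : I ≤ J :=
  Submodule.le_of_le_smul_of_le_jacobson_bot hI (maximalIdeal_le_jacobson _) h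

variable [IsNoetherianRing R]

/-- An ideal properly contained in `I` is generated modulo `𝔪 I` by fewer elements than `I`. -/
theorem Ideal.exists_finset_card_lt_spanFinrank {c I : Ideal R} (h : c < I) :
    ∃ w : Finset R, (w : Set R) ⊆ c ∧ w.card < I.spanFinrank ∧
      c ≤ Ideal.span w ⊔ maximalIdeal R * I := by
  classical
  have hI : I.FG := IsNoetherian.noetherian I
  let κ := R ⧸ maximalIdeal R
  let V := I ⧸ (maximalIdeal R • ⊤ : Submodule R I)
  let _ : Field κ := Ideal.Quotient.field _
  have hsur : Function.Surjective (algebraMap R κ) := Ideal.Quotient.mk_surjective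
  let mk : I →ₗ[R] V := Submodule.mkQ _
  let T : Set V := mk '' {x | (x : R) ∈ c}
  obtain ⟨b, hbT, hspan, hli⟩ := exists_linearIndependent κ T
  have : Module.Finite R V := inferInstance
  have : Module.Finite κ V := Module.Finite.of_restrictScalars_finite R κ V
  have hker : ∀ x : I, mk x = 0 → (x : R) ∈ maximalIdeal R * I := fun x hx => by
    have h1 := (Submodule.Quotient.mk_eq_zero _).1 hx
    have h2 := Submodule.mem_map_of_mem (f := Submodule.subtype I) h1
    rwa [Submodule.map_smul'', Submodule.map_top, Submodule.range_subtype] at h2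
  have hbfin : b.Finite := hli.setFinite
  have hlift : ∀ y : V, ∃ x : I, y ∈ b → (x : R) ∈ c ∧ mk x = y := fun y => by
    by_cases hy : y ∈ b
    · obtain ⟨x, hx, rfl⟩ := hbT hy
      exact ⟨x, fun _ => ⟨hx, rfl⟩⟩
    · exact ⟨0, fun h => absurd h hy⟩
  choose g hg using hlift
  have hle : ∀ x : I, mk x ∈ Submodule.span κ b →
      (x : R) ∈ Ideal.span ((fun y => (g y : R)) '' b) ⊔ maximalIdeal R * I := by
    intro x hx
    have hb : b = mk '' (g '' b) := by
      rw [Set.image_image]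
      exact (Set.image_congr fun y hy => (hg y hy).2).trans (Set.image_id b) |>.symm
    rw [← Submodule.restrictScalars_mem R, Submodule.restrictScalars_span _ _ hsur, hb,
      ← Submodule.map_span] at hx
    obtain ⟨y, hy, hyx⟩ := hx
    have h1 := hker (x - y) (by rw [map_sub, hyx, sub_self])
    have h2 : (y : R) ∈ Ideal.span ((fun y => (g y : R)) '' b) := by
      have := Submodule.mem_map_of_mem (f := Submodule.subtype I) hy
      rwa [Submodule.map_span, Set.image_image] at this
    have := Submodule.add_mem_sup h2 h1
    rwa [AddSubgroupClass.coe_sub, add_sub_cancel] at this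
  refine ⟨hbfin.toFinset.image fun y => (g y : R), ?_, ?_, ?_⟩
  · intro z hz
    obtain ⟨y, hy, rfl⟩ := Finset.mem_image.1 hz
    exact (hg y (hbfin.mem_toFinset.1 hy)).1
  · refine Finset.card_image_le.trans_lt ?_
    rw [spanFinrank_eq_finrank_quotient I hI, ← Set.ncard_eq_toFinset_card b hbfin]
    -- The image of `c` in `I / 𝔪 I` is a proper subspace, by Nakayama.
    have hne : Submodule.span κ b ≠ ⊤ := fun htop => by
      have h1 : I ≤ c ⊔ maximalIdeal R * I := fun x hx =>
        (sup_le_sup_right (Ideal.span_le.2 (by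
          rintro _ ⟨y, hy, rfl⟩; exact (hg y hy).1)) _ :
          Ideal.span ((fun y => (g y : R)) '' b) ⊔ maximalIdeal R * I ≤ _)
          (hle ⟨x, hx⟩ (htop ▸ Submodule.mem_top))
      exact h.not_ge (Ideal.le_of_le_sup_maximalIdeal_mul hI h1)
    have h2 := Submodule.finrank_lt hne
    let _ := hbfin.fintype
    rwa [finrank_span_set_eq_card hli, ← Set.ncard_eq_toFinset_card'] at h2
  · intro x hx
    have hxI := h.le hx
    rw [Finset.coe_image, Set.Finite.coe_toFinset]
    exact hle ⟨x, hxI⟩ (hspan ▸ Submodule.subset_span ⟨⟨x, hxI⟩, hx, rfl⟩)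

/-- By Nakayama's lemma, being a reduction of `I` depends only on the ideal modulo `𝔪 I`. -/
theorem IsReduction.of_le_sup {I c J : Ideal R} (hc : IsReduction c I) (hJ : J ≤ I)
    (h : c ≤ J ⊔ maximalIdeal R * I) : IsReduction J I := by
  obtain ⟨-, n, hn⟩ := hc
  refine ⟨hJ, n, le_antisymm ?_ ?_⟩
  · rw [pow_succ']; exact Ideal.mul_mono_left hJ
  · refine Ideal.le_of_le_sup_maximalIdeal_mul (IsNoetherian.noetherian _) ?_
    calc I ^ (n + 1) = c * I ^ n := hn.symm
      _ ≤ (J ⊔ maximalIdeal R * I) * I ^ n := Ideal.mul_mono_left h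
      _ = J * I ^ n ⊔ maximalIdeal R * I ^ (n + 1) := by
        rw [Ideal.sup_mul, mul_assoc, pow_succ']

/-- A reduction with the least number of generators is minimal. -/
theorem exists_isMinimalReduction (I : Ideal R) : ∃ c : Ideal R, IsMinimalReduction c I := by
  classical
  have hex : ∃ m, ∃ c : Ideal R, IsReduction c I ∧ c.spanFinrank = m :=
    ⟨_, I, ⟨le_rfl, 0, by simp⟩, rfl⟩
  obtain ⟨c, hc, hcm⟩ := Nat.find_spec hex
  refine ⟨c, hc, fun c' hc' hle => ?_⟩
  by_contra hlt
  obtain ⟨w, hw, hcard, hle'⟩ := Ideal.exists_finset_card_lt_spanFinrank (lt_of_le_not_ge hle hlt)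
  have hred : IsReduction (Ideal.span w) I :=
    hc'.of_le_sup ((Ideal.span_le.2 hw).trans hc'.1)
      (hle'.trans (sup_le_sup_left (Ideal.mul_mono_right hc.1) _))
  refine Nat.find_min hex (hcm ▸ hcard.trans_le' ?_) ⟨_, hred, rfl⟩
  exact (Submodule.spanFinrank_span_le_ncard_of_finite w.finite_toSet).trans
    (Set.ncard_coe_finset w).le

end

section

open MvPolynomial

/-- Expanding a product of `s + 1` elements of `c + J`, every term but those in `J ^ (s + 1)` has a
factor in `c`. -/
theorem Ideal.pow_succ_le_mul_pow_sup_pow {R : Type*} [CommRing R] {M c J : Ideal R}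
    (h : M ≤ c ⊔ J) (hc : J ≤ M) (s : ℕ) : M ^ (s + 1) ≤ c * M ^ s ⊔ J ^ (s + 1) := by
  induction s with
  | zero => simpa using h
  | succ s ih =>
    calc M ^ (s + 1 + 1) = M * M ^ (s + 1) := pow_succ' _ _
      _ ≤ (c ⊔ J) * M ^ (s + 1) := Ideal.mul_mono_left h
      _ = c * M ^ (s + 1) ⊔ J * M ^ (s + 1) := Ideal.sup_mul _ _ _
      _ ≤ c * M ^ (s + 1) ⊔ J * (c * M ^ s ⊔ J ^ (s + 1)) :=
        sup_le_sup_left (Ideal.mul_mono_right ih) _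
      _ ≤ c * M ^ (s + 1) ⊔ J ^ (s + 1 + 1) := by
        rw [Ideal.mul_sup, ← pow_succ', mul_left_comm, pow_succ' M s]
        exact sup_le le_sup_left
          (sup_le ((Ideal.mul_mono_right (Ideal.mul_mono_left hc)).trans le_sup_left) le_sup_right)

variable {n : ℕ} {k : Type*} [Field k]

namespace MvPolynomial

/-- The ideal of the line through the origin and the point `a`, where `a i₀ ≠ 0`. -/
noncomputable def lineIdeal (a : Fin n → k) (i₀ : Fin n) : Ideal (MvPolynomial (Fin n) k) :=
  Ideal.span ((fun j => C (a i₀) * X j - C (a j) * X i₀) '' {j | j ≠ i₀})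

theorem isHomogeneous_lineIdeal (a : Fin n → k) (i₀ : Fin n) :
    (lineIdeal a i₀).IsHomogeneous (homogeneousSubmodule (Fin n) k) := by
  refine Ideal.homogeneous_span _ _ ?_
  rintro _ ⟨j, -, rfl⟩
  exact ⟨1, ((isHomogeneous_X k j).C_mul (a i₀)).sub ((isHomogeneous_X k i₀).C_mul (a j))⟩

theorem eval_eq_zero_of_mem_lineIdeal {a : Fin n → k} {i₀ : Fin n} {F : MvPolynomial (Fin n) k}
    (hF : F ∈ lineIdeal a i₀) : eval a F = 0 := by
  have h : lineIdeal a i₀ ≤ RingHom.ker (eval a) := by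
    refine Ideal.span_le.2 ?_
    rintro _ ⟨j, -, rfl⟩
    simp [mul_comm]
  exact h hF

theorem idealOfVars_le_lineIdeal_sup {a : Fin n → k} {i₀ : Fin n} (ha : a i₀ ≠ 0) :
    idealOfVars (Fin n) k ≤ lineIdeal a i₀ ⊔ Ideal.span {X i₀} := by
  refine Ideal.span_le.2 ?_
  rintro _ ⟨j, rfl⟩
  by_cases hj : j = i₀
  · subst hj
    exact Ideal.mem_sup_right (Ideal.mem_span_singleton_self _)
  have h1 : C (a i₀) * X j - C (a j) * X i₀ ∈ lineIdeal a i₀ := Ideal.subset_span ⟨j, hj, rfl⟩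
  have h2 : (X j : MvPolynomial (Fin n) k) = C (a i₀)⁻¹ * (C (a i₀) * X j - C (a j) * X i₀) +
      C (a i₀)⁻¹ * C (a j) * X i₀ := by
    have h3 : (C (a i₀)⁻¹ * C (a i₀) : MvPolynomial (Fin n) k) = 1 := by
      rw [← C_mul, inv_mul_cancel₀ ha, C_1]
    linear_combination (-X j) * h3
  rw [h2]
  exact Submodule.add_mem_sup (Ideal.mul_mem_left _ _ h1)
    (Ideal.mul_mem_left _ _ (Ideal.mem_span_singleton_self _))

/-- A form `F` of degree `s + 1` not vanishing at `a` generates, modulo the line through `a` and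
higher order, all forms of degree `s + 1`. -/
theorem idealOfVars_pow_le_of_eval_ne_zero {a : Fin n → k} {i₀ : Fin n} (ha : a i₀ ≠ 0) {s : ℕ}
    {F : MvPolynomial (Fin n) k} (hF : F.IsHomogeneous (s + 1)) (hFa : eval a F ≠ 0) :
    idealOfVars (Fin n) k ^ (s + 1) ≤ lineIdeal a i₀ * idealOfVars (Fin n) k ^ s ⊔
      Ideal.span {F} ⊔ idealOfVars (Fin n) k ^ (s + 2) := by
  set M := idealOfVars (Fin n) k with hM
  have hX : Ideal.span {X i₀} ≤ M := (Ideal.span_singleton_le_iff_mem _).2 (X_mem_idealOfVars i₀)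
  have h1 := Ideal.pow_succ_le_mul_pow_sup_pow (idealOfVars_le_lineIdeal_sup ha) hX s
  rw [Ideal.span_singleton_pow] at h1
  refine h1.trans (sup_le (le_sup_left.trans le_sup_left)
    ((Ideal.span_singleton_le_iff_mem _).2 ?_))
  obtain ⟨y, hy, z, hz, hyz⟩ := Submodule.mem_sup.1 (h1 hF.mem_pow_idealOfVars)
  obtain ⟨q, rfl⟩ := Ideal.mem_span_singleton'.1 hz
  have hXs : (X i₀ ^ (s + 1) : MvPolynomial (Fin n) k).IsHomogeneous (s + 1) := by
    simpa using (isHomogeneous_X k i₀).pow (s + 1)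
  have hq1 : q - C (coeff 0 q) ∈ M := by
    rw [hM, ← pow_one (idealOfVars (Fin n) k), mem_pow_idealOfVars_iff']
    intro x hx
    have : x = 0 := by
      rw [← Finsupp.degree_eq_zero_iff]; omega
    simp [this]
  have hq2 : (q - C (coeff 0 q)) * X i₀ ^ (s + 1) ∈ M ^ (s + 2) := by
    rw [pow_succ' M (s + 1)]
    exact Ideal.mul_mem_mul hq1 hXs.mem_pow_idealOfVars
  have hq0 : coeff 0 q ≠ 0 := by
    intro h0
    rw [h0, C_0, sub_zero] at hq2
    have hle : lineIdeal a i₀ * M ^ s ≤ lineIdeal a i₀ := Ideal.mul_le_left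
    have h3 : F ∈ lineIdeal a i₀ := by
      rw [← homogeneousComponent_eq_self hF, ← hyz, map_add,
        homogeneousComponent_eq_zero_of_mem_pow_idealOfVars hq2 (Nat.lt_succ_self _), add_zero]
      exact homogeneousComponent_mem_of_mem (isHomogeneous_lineIdeal a i₀)
        (hle hy) _
    exact hFa (eval_eq_zero_of_mem_lineIdeal h3)
  have h4 : (X i₀ ^ (s + 1) : MvPolynomial (Fin n) k) = C (coeff 0 q)⁻¹ * (-y) +
      C (coeff 0 q)⁻¹ * F + C (coeff 0 q)⁻¹ * -((q - C (coeff 0 q)) * X i₀ ^ (s + 1)) := by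
    have h5 : (C (coeff 0 q)⁻¹ * C (coeff 0 q) : MvPolynomial (Fin n) k) = 1 := by
      rw [← C_mul, inv_mul_cancel₀ hq0, C_1]
    linear_combination (-X i₀ ^ (s + 1)) * h5 + C (coeff 0 q)⁻¹ * hyz
  rw [h4]
  exact Submodule.add_mem_sup (Submodule.add_mem_sup (Ideal.mul_mem_left _ _ (neg_mem hy))
    (Ideal.mul_mem_left _ _ (Ideal.mem_span_singleton_self _)))
    (Ideal.mul_mem_left _ _ (neg_mem hq2))

end MvPolynomial

end

section

open MvPolynomial

variable {n : ℕ} {S B : Type*} [CommRing S] [IsLocalRing S] [IsNoetherianRing S] [CommRing B]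
  [IsLocalRing B] {π : S →+* B}

/-- An ideal of `S` primary to the maximal ideal needs at least `dim S = n` generators. -/
theorem IsOriginApproximation.le_ncard_of_pow_le_span (k : Type*) [Field k]
    [Algebra (MvPolynomial (Fin n) k) S] [IsOriginApproximation n k S] {w : Set S} (hw : w.Finite)
    (hle : Ideal.span w ≤ maximalIdeal S) {i : ℕ} (h : maximalIdeal S ^ i ≤ Ideal.span w) :
    n ≤ w.ncard := by
  have hrad : (Ideal.span w).radical = maximalIdeal S :=
    le_antisymm ((Ideal.IsPrime.radical_le_iff inferInstance).2 hle)
      fun x hx => ⟨i, h (Ideal.pow_mem_pow hx i)⟩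
  have h1 := (le_ringKrullDim n S k).trans (ringKrullDim_le_spanFinrank_of_radical_eq hrad)
  have h2 : n ≤ (Ideal.span w).spanFinrank := by exact_mod_cast h1
  exact h2.trans (Submodule.spanFinrank_span_le_ncard_of_finite hw)

/-- If `S → B` is not injective and the residue field is infinite, the ideal of a line through the
origin not contained in the tangent cone of `B` induces a reduction of the maximal ideal of `B`. -/
theorem exists_isReduction_ne_maximalIdeal (n : ℕ) (k : Type*) [Field k] [Infinite k]
    [Algebra (MvPolynomial (Fin n) k) S] [IsOriginApproximation n k S]
    (hπ : Function.Surjective π) (hker : RingHom.ker π ≤ maximalIdeal S ^ 2)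
    (hne : RingHom.ker π ≠ ⊥) :
    ∃ c : Ideal B, IsReduction c (maximalIdeal B) ∧ c ≠ maximalIdeal B := by
  -- The initial form `F` of a nonzero equation `f` of `B` does not vanish at some `a ≠ 0`, and the
  -- line through `a` is not contained in the tangent cone.
  obtain ⟨f, hf, hf0⟩ := Submodule.exists_mem_ne_zero_of_ne_bot hne
  have hex : ∃ s, f ∉ maximalIdeal S ^ s := by
    by_contra! hcon
    refine hf0 ?_
    rw [← Ideal.mem_bot, ← Ideal.iInf_pow_eq_bot_of_isLocalRing (maximalIdeal S)
      Ideal.IsPrime.ne_top']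
    exact (Submodule.mem_iInf _).2 hcon
  classical
  obtain ⟨s, hs, hs'⟩ : ∃ s, f ∈ maximalIdeal S ^ (s + 1) ∧ f ∉ maximalIdeal S ^ (s + 2) := by
    have h1 := Nat.find_spec hex
    have h2 : ¬ Nat.find hex ≤ 2 := fun hle => h1 (Ideal.pow_le_pow_right hle (hker hf))
    obtain ⟨s, hs⟩ := Nat.exists_eq_add_of_le' (not_le.1 h2).le
    refine ⟨s, not_not.1 (Nat.find_min hex (by omega)), hs ▸ h1⟩
  obtain ⟨F, hF, hfF⟩ := IsOriginApproximation.exists_isHomogeneous_sub_mem n k hs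
  have hF0 : F ≠ 0 := by
    rintro rfl
    rw [map_zero, sub_zero] at hfF
    exact hs' hfF
  obtain ⟨a, ha⟩ : ∃ a, eval a F ≠ 0 := by
    by_contra! hcon
    exact hF0 (hF.eq_zero_of_forall_eval_eq_zero hcon)
  obtain ⟨i₀, hi₀⟩ : ∃ i₀, a i₀ ≠ 0 := by
    by_contra! hcon
    have ha0 : a = 0 := funext hcon
    have h0 : eval (0 : Fin n → k) F = coeff 0 F := by
      rw [eval_zero, constantCoeff_eq]
    refine ha ?_
    rw [ha0, h0]
    exact hF.coeff_eq_zero (by simp)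
  have hB : IsNoetherianRing B := isNoetherianRing_of_surjective _ _ π hπ
  have hmap : (idealOfVars (Fin n) k).map (π.comp (algebraMap _ S)) = maximalIdeal B := by
    rw [← Ideal.map_map, IsOriginApproximation.map_eq, map_maximalIdeal_of_surjective π hπ]
  have hl : lineIdeal a i₀ ≤ idealOfVars (Fin n) k := by
    refine Ideal.span_le.2 ?_
    rintro _ ⟨j, -, rfl⟩
    exact sub_mem (Ideal.mul_mem_left _ _ (X_mem_idealOfVars j))
      (Ideal.mul_mem_left _ _ (X_mem_idealOfVars i₀))
  refine ⟨(lineIdeal a i₀).map (π.comp (algebraMap _ S)), ⟨hmap ▸ Ideal.map_mono hl, s, ?_⟩, ?_⟩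
  · refine le_antisymm ?_ ?_
    · rw [pow_succ']; exact Ideal.mul_mono_left (hmap ▸ Ideal.map_mono hl)
    refine Ideal.le_of_le_sup_maximalIdeal_mul (IsNoetherian.noetherian _) ?_
    have h1 := Ideal.map_mono (f := π.comp (algebraMap _ S))
      (idealOfVars_pow_le_of_eval_ne_zero hi₀ hF ha)
    rw [Ideal.map_sup, Ideal.map_sup, Ideal.map_mul, Ideal.map_pow, Ideal.map_pow, Ideal.map_pow,
      hmap] at h1
    refine h1.trans (sup_le (sup_le le_sup_left ?_) ?_)
    · rw [Ideal.map_span, Set.image_singleton, Ideal.span_singleton_le_iff_mem, RingHom.comp_apply]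
      refine Ideal.mem_sup_right ?_
      have h2 : π (algebraMap _ S F) = -π (f - algebraMap _ S F) := by
        rw [map_sub, (RingHom.mem_ker).1 hf, zero_sub, neg_neg]
      rw [h2, ← pow_succ', neg_mem_iff, ← map_maximalIdeal_pow_of_surjective hπ]
      exact Ideal.mem_map_of_mem π hfF
    · rw [← pow_succ']
      exact le_sup_right
  -- The equations of `B` have order at least two, so if the `n - 1` equations of the line generated
  -- the maximal ideal of `B`, they would generate that of `S`.
  · intro heq
    have hS : maximalIdeal S ≤ (lineIdeal a i₀).map (algebraMap _ S) := by
      refine Ideal.le_of_le_sup_maximalIdeal_mul (IsNoetherian.noetherian _) ?_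
      rw [← Ideal.map_map, ← map_maximalIdeal_of_surjective π hπ] at heq
      have h3 := congrArg (Ideal.comap π) heq
      rw [Ideal.comap_map_of_surjective' π hπ, Ideal.comap_map_of_surjective' π hπ] at h3
      rw [← pow_two]
      exact le_sup_left.trans (h3.ge.trans (sup_le_sup_left hker _))
    rw [lineIdeal, Ideal.map_span, Set.image_image] at hS
    have hfin : ({j | j ≠ i₀} : Set (Fin n)).Finite := Set.toFinite _
    have hle : Ideal.span ((fun j => algebraMap (MvPolynomial (Fin n) k) S
        (C (a i₀) * X j - C (a j) * X i₀)) '' {j | j ≠ i₀}) ≤ maximalIdeal S := by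
      rw [← IsOriginApproximation.map_eq (n := n) (k := k)]
      refine Ideal.span_le.2 ?_
      rintro _ ⟨j, hj, rfl⟩
      exact Ideal.mem_map_of_mem _ (hl (Ideal.subset_span ⟨j, hj, rfl⟩))
    have h4 := IsOriginApproximation.le_ncard_of_pow_le_span (n := n) k (hfin.image _) hle (i := 1)
      (by rwa [pow_one])
    have h5 := h4.trans (Set.ncard_image_le hfin)
    have h6 : ({j | j ≠ i₀} : Set (Fin n)).ncard < n := by
      have := Set.ncard_lt_ncard (s := {j | j ≠ i₀}) (t := Set.univ)
        ⟨Set.subset_univ _, fun h => h (Set.mem_univ i₀) rfl⟩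
      rwa [Set.ncard_univ, Nat.card_fin] at this
    omega

/-- If `B` is defined by equations of order at least `r + 2`, every proper reduction `c` of its
maximal ideal has reduction number greater than `r`: up to order `r + 1`, an equality
`c 𝔫ⁱ = 𝔫ⁱ⁺¹` lifts to `S`, whose maximal ideal has no reduction with fewer generators. -/
theorem lt_of_mul_pow_eq_pow_succ {k : Type*} [Field k] [Algebra (MvPolynomial (Fin n) k) S]
    [IsOriginApproximation n k S] {r : ℕ}
    (hπ : Function.Surjective π) (hker : RingHom.ker π ≤ maximalIdeal S ^ (r + 2)) {c : Ideal B}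
    (hc : c < maximalIdeal B) {i : ℕ} (hi : c * maximalIdeal B ^ i = maximalIdeal B ^ (i + 1)) :
    r < i := by
  classical
  by_contra! hir
  have hB : IsNoetherianRing B := isNoetherianRing_of_surjective _ _ π hπ
  obtain ⟨w, hwc, hcard, hle⟩ := Ideal.exists_finset_card_lt_spanFinrank hc
  obtain ⟨g, hg : ∀ b, π (g b) = b⟩ := hπ.hasRightInverse
  have hgw : Ideal.span (w.image g : Set S) ≤ maximalIdeal S := by
    refine Ideal.span_le.2 fun y hy => ?_
    obtain ⟨z, hz, rfl⟩ := Finset.mem_image.1 hy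
    have h1 : π (g z) ∈ maximalIdeal B ^ 1 := by rw [hg, pow_one]; exact hc.le (hwc hz)
    rw [map_mem_maximalIdeal_pow_iff hπ, pow_one] at h1
    exact (sup_le le_rfl (hker.trans (Ideal.pow_le_self (by omega)))) h1
  have hmap : (Ideal.span (w.image g : Set S)).map π = Ideal.span w := by
    rw [Ideal.map_span, Finset.coe_image, Set.image_image]
    simp [hg]
  have hpow : maximalIdeal S ^ (i + 1) ≤ Ideal.span (w.image g : Set S) * maximalIdeal S ^ i := by
    refine Ideal.le_of_le_sup_maximalIdeal_mul (IsNoetherian.noetherian _) ?_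
    have h1 : (maximalIdeal S ^ (i + 1)).map π ≤ (Ideal.span (w.image g : Set S) *
        maximalIdeal S ^ i ⊔ maximalIdeal S * maximalIdeal S ^ (i + 1)).map π := by
      rw [Ideal.map_sup, Ideal.map_mul, Ideal.map_mul, hmap,
        map_maximalIdeal_pow_of_surjective hπ, map_maximalIdeal_pow_of_surjective hπ,
        map_maximalIdeal_of_surjective π hπ, ← hi]
      refine (Ideal.mul_mono_left hle).trans ?_
      rw [Ideal.sup_mul, hi, mul_assoc, ← pow_succ']
    rw [Ideal.map_le_iff_le_comap, Ideal.comap_map_of_surjective' π hπ] at h1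
    refine h1.trans (sup_le le_rfl (hker.trans (le_sup_of_le_right ?_)))
    rw [← pow_succ']
    exact Ideal.pow_le_pow_right (by omega)
  have h2 := IsOriginApproximation.le_ncard_of_pow_le_span (n := n) k (w.image g).finite_toSet hgw
    (hpow.trans Ideal.mul_le_left)
  rw [Set.ncard_coe_finset] at h2
  have h3 : (maximalIdeal B).spanFinrank ≤ n := by
    rw [← map_maximalIdeal_of_surjective π hπ]
    exact (Ideal.spanFinrank_map_le_of_fg π (maximalIdeal S).fg_of_isNoetherianRing).trans
      (IsOriginApproximation.spanFinrank_maximalIdeal_le n S k)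
  have h4 := Finset.card_image_le (s := w) (f := g)
  omega

/-- If `S → B` is not injective, has kernel of order at least `r + 2`, and `k` is infinite, then the
maximal ideal of `B` has reduction number greater than `r`. -/
theorem lt_reductionNumber_maximalIdeal {k : Type u} [Field k] [Infinite k] {S B : Type u}
    [CommRing S] [IsLocalRing S] [IsNoetherianRing S] [Algebra (MvPolynomial (Fin n) k) S]
    [IsOriginApproximation n k S] [CommRing B] [IsLocalRing B] {π : S →+* B} {r : ℕ}
    (hπ : Function.Surjective π) (hker : RingHom.ker π ≤ maximalIdeal S ^ (r + 2))
    (hne : RingHom.ker π ≠ ⊥) : r < reductionNumber (maximalIdeal B) := by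
  have hB : IsNoetherianRing B := isNoetherianRing_of_surjective _ _ π hπ
  obtain ⟨c, hc⟩ := exists_isMinimalReduction (maximalIdeal B)
  -- The sets defining the reduction numbers are not empty, so that the infima are attained.
  obtain ⟨c', hc', hi⟩ := Nat.sInf_mem (s := {m : ℕ | ∃ 𝔠 : Ideal B,
    IsMinimalReduction 𝔠 (maximalIdeal B) ∧ reductionNumberWrt 𝔠 (maximalIdeal B) = m})
    ⟨_, c, hc, rfl⟩
  rw [reductionNumber, ← hi]
  have h1 : c' * maximalIdeal B ^ reductionNumberWrt c' (maximalIdeal B) = _ :=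
    Nat.sInf_mem hc'.1.2
  refine lt_of_mul_pow_eq_pow_succ (n := n) (k := k) hπ hker
    (lt_of_le_of_ne hc'.1.1 fun heq => ?_) h1
  -- A minimal reduction is proper, since there is a proper one.
  obtain ⟨c₀, hc₀, hne₀⟩ := exists_isReduction_ne_maximalIdeal n k hπ
    (hker.trans (Ideal.pow_le_pow_right (by omega))) hne
  exact hne₀ (le_antisymm hc₀.1 (heq ▸ hc'.2 hc₀ (heq ▸ hc₀.1)))

end

/-! ### Existence of approximations -/

theorem exists_sub_mem_maximalIdeal_of_residue_comp_eq_id {A : Type*} [CommRing A] [IsLocalRing A]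
    {σ : ResidueField A →+* A} (hσ : (residue A).comp σ = RingHom.id _) (x : A) :
    ∃ c, x - σ c ∈ maximalIdeal A :=
  ⟨residue A x, Ideal.Quotient.eq.1 (RingHom.congr_fun hσ (residue A x)).symm⟩

theorem mainTheorem5 {A : Type u} [CommRing A] [IsLocalRing A] [IsNoetherianRing A]
    (hcomplete : IsAdicComplete (maximalIdeal A) A)
    (hequichar : ringChar A = ringChar (ResidueField A))
    (𝔞 : Ideal A) (hprimary : 𝔞.radical = maximalIdeal A) :
    (∃ (B : Type u) (_ : CommRing B) (_ : IsLocalRing B) (φ : B →+* A) (_ : IsLocalHom φ),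
      IsCIApproximation φ (maximalIdeal B) 𝔞 ∧
      Function.Bijective (ResidueField.map φ) ∧
      (maximalIdeal B).spanFinrank = 𝔞.spanFinrank) ∧
    (ringKrullDim A < (𝔞.spanFinrank : WithBot ℕ∞) → Infinite (ResidueField A) →
      ∀ r : ℕ,
        ∃ (B : Type u) (_ : CommRing B) (_ : IsLocalRing B) (φ : B →+* A) (_ : IsLocalHom φ),
          IsCIApproximation φ (maximalIdeal B) 𝔞 ∧
          Function.Bijective (ResidueField.map φ) ∧
          (maximalIdeal B).spanFinrank = 𝔞.spanFinrank ∧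
          r < reductionNumber (maximalIdeal B)) := by
  obtain ⟨σ, hσ⟩ := exists_coefficientField hequichar
  have hσ' := exists_sub_mem_maximalIdeal_of_residue_comp_eq_id hσ
  refine ⟨?_, fun hlt hinf r => ?_⟩
  · obtain ⟨B, _, _, φ, _, π, happrox, hres, hrank, -⟩ :=
      exists_isCIApproximation σ hσ' hprimary rfl 0
    exact ⟨B, _, _, φ, _, happrox, hres, hrank⟩
  · obtain ⟨B, _, _, φ, _, π, happrox, hres, hrank, hπ, hker, hne⟩ :=
      exists_isCIApproximation σ hσ' hprimary rfl r
    exact ⟨B, _, _, φ, _, happrox, hres, hrank,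
      lt_reductionNumber_maximalIdeal (n := 𝔞.spanFinrank) (k := ResidueField A) hπ
        hker (hne hlt)⟩
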